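/- Let $X_1,X_2,\dots$ be i.i.d. real random variables on a probability space $(\Omega,\mathcal F,P)$ with $P(X_1>0)>0$, and let $(\mathcal A_n)_{n\ge 0}$ be a filtration such that $X_{n+1}$ is $\mathcal A_{n+1}$-measurable and independent of $\mathcal A_n$ for all $n\ge 0$. Put $S_n=X_1+\dots+X_n$ ($S_0=0$) and, for $y\in\mathbb R$, let $Y_n=y+S_n$ under $P_y$. Let $0<\rho\le 1$, and let $g:\mathbb R\to[0,\infty)$ be measurable with $\{g>0\}=\{y\in\mathbb R:y>b\}$ for some $b\in\mathbb R\cup\{-\infty\}$. For a random time $\tau$ with values in $\{0,1,2,\dots\}\cup\{\infty\}$ put $\rho^\tau:=0$ and $\rho^{\tau}g(Y_\tau):=0$ on $\{\tau=\infty\}$. Let \[ V(y)=\sup_\tau E_y\,\rho^\tau g(Y_\tau),\qquad S^*=\{y: V(y)=g(y)\}, \] where the supremum is over all $(\mathcal A_n)$-stopping times with values in $\{0,1,2,\dots\}\cup\{\infty\}$; a stopping time is called optimal (for the starting point $y$) if it attains $V(y)$. Let $\tau_y=\inf\{n>0: Y_n>y\}$ and \[ \phi(y)=E_y\,\rho^{\tau_y}g(Y_{\tau_y}),\qquad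 f(y)=\frac{g(y)-\phi(y)}{1-E_y\rho^{\tau_y}},\qquad \alpha^*=\inf\{z>b:\phi(z)\le g(z)\}\in[-\infty,\infty], \] and let $\tau_+=\inf\{n>0:S_n>0\}$ be the first strict ascending ladder time. (Under the assumptions made below, $\phi$ is finite and $E_y\rho^{\tau_y}<1$, so that $f$ is well defined.) Then \[ \alpha^*=\inf\Big\{z>b:\ E\,\rho^{\tau_+}\frac{g(z+S_{\tau_+})}{g(z)}\le 1\Big\}. \] Assume now that $\alpha^*\in\mathbb R$, that $g$ is (weakly) increasing on $[\alpha^*,\infty)$ and log-concave on $(\alpha^*,\infty)$, and that condition (Opt) holds: for every $y\in\mathbb R$, \[ E_y\sup_{n}\rho^n g(Y_n)<\infty\quad\text{and}\quad \rho^n g(Y_n)\to 0\ \ P_y\text{-a.s. as } n\to\infty . \] (i) If $f(\alpha^*)\ge 0$, then $\tau^*=\inf\{n\ge 0:Y_n\ge\alpha^*\}$ is an optimal stopping time for every starting point $y\in\mathbb R$, and $S^*=[\alpha^*,\infty)$. (ii) If $f(\alpha^*)\le 0$, then $\tau^*=\inf\{n\ge 0:Y_n>\alpha^*\}$ is an optimal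 stopping time for every starting point $y\in\mathbb R$. -/

import Mathlib

open MeasureTheory ProbabilityTheory Filter Topology
open scoped ENNReal

namespace LadderStopping

/-- `X 0, X 1, …` (the steps `X₁, X₂, …`) are the steps of a random walk relative to the filtration
`ℱ`: the `(n+1)`-st step is known at time `n+1`, is independent of the information available at
time `n`, and all steps have the same law. In particular the steps are i.i.d., and the walk is
a Markov process with respect to `ℱ` from every starting point. -/
structure IsRandomWalk {Ω : Type*} {m : MeasurableSpace Ω} (P : Measure Ω)
    (ℱ : Filtration ℕ m) (X : ℕ → Ω → ℝ) : Prop where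
  measurable_step : ∀ n, Measurable[ℱ (n + 1)] (X n)
  indep_past : ∀ n, Indep (MeasurableSpace.comap (X n) inferInstance) (ℱ n) P
  identDistrib : ∀ n, IdentDistrib (X n) (X 0) P P

/-- The walk with starting point `y`: `Yₙ = y + X₁ + ⋯ + Xₙ`. -/
def walk {Ω : Type*} (X : ℕ → Ω → ℝ) (y : ℝ) (n : ℕ) (ω : Ω) : ℝ :=
  y + ∑ i ∈ Finset.range n, X i ω

/-- `ρ^τ g(Y_τ)`, which is `0` where `τ = ∞`. -/
noncomputable def discountedReward {Ω : Type*} (ρ : ℝ) (g : ℝ → ℝ) (Y : ℕ → Ω → ℝ)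
    (τ : Ω → WithTop ℕ) (ω : Ω) : ℝ :=
  match τ ω with
  | ⊤ => 0
  | (n : ℕ) => ρ ^ n * g (Y n ω)

/-- `E ρ^τ g(Y_τ)`, an element of `[0, ∞]`. -/
noncomputable def expectedReward {Ω : Type*} {m : MeasurableSpace Ω} (P : Measure Ω)
    (ρ : ℝ) (g : ℝ → ℝ) (Y : ℕ → Ω → ℝ) (τ : Ω → WithTop ℕ) : ℝ≥0∞ :=
  ∫⁻ ω, ENNReal.ofReal (discountedReward ρ g Y τ ω) ∂P

/-- The value function `V(y) = sup_τ E_y ρ^τ g(Y_τ)`, over all stopping times of `ℱ` with values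
in `{0, 1, 2, …} ∪ {∞}`. -/
noncomputable def value {Ω : Type*} {m : MeasurableSpace Ω} (P : Measure Ω)
    (ℱ : Filtration ℕ m) (X : ℕ → Ω → ℝ) (ρ : ℝ) (g : ℝ → ℝ) (y : ℝ) : ℝ≥0∞ :=
  ⨆ (τ : Ω → WithTop ℕ) (_ : IsStoppingTime ℱ τ), expectedReward P ρ g (walk X y) τ

/-- The stopping set `S* = {y : V(y) = g(y)}`. -/
def stoppingSet {Ω : Type*} {m : MeasurableSpace Ω} (P : Measure Ω)
    (ℱ : Filtration ℕ m) (X : ℕ → Ω → ℝ) (ρ : ℝ) (g : ℝ → ℝ) : Set ℝ :=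
  {y | value P ℱ X ρ g y = ENNReal.ofReal (g y)}

/-- The entrance time into `A`, `inf {n ≥ 0 : Yₙ ∈ A}` (with `inf ∅ = ∞`), is optimal for every
starting point `y`. -/
def EntranceTimeOptimal {Ω : Type*} {m : MeasurableSpace Ω} (P : Measure Ω)
    (ℱ : Filtration ℕ m) (X : ℕ → Ω → ℝ) (ρ : ℝ) (g : ℝ → ℝ) (A : Set ℝ) : Prop :=
  ∀ y : ℝ, IsStoppingTime ℱ (hittingAfter (walk X y) A 0) ∧
    expectedReward P ρ g (walk X y) (hittingAfter (walk X y) A 0) = value P ℱ X ρ g y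

/-- For every starting point `y`: `E_y supₙ ρⁿ g(Yₙ) < ∞`, and `ρⁿ g(Yₙ) → 0` almost surely. -/
def ConditionOpt {Ω : Type*} {m : MeasurableSpace Ω} (P : Measure Ω)
    (X : ℕ → Ω → ℝ) (ρ : ℝ) (g : ℝ → ℝ) : Prop :=
  ∀ y : ℝ, (∫⁻ ω, ⨆ n : ℕ, ENNReal.ofReal (ρ ^ n * g (walk X y n ω)) ∂P < ∞) ∧
    ∀ᵐ ω ∂P, Tendsto (fun n : ℕ => ρ ^ n * g (walk X y n ω)) atTop (𝓝 0)

/-- `τ_y = inf {n > 0 : Yₙ > y}` for the walk started at `y`. -/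
noncomputable def exceedTime {Ω : Type*} (X : ℕ → Ω → ℝ) (y : ℝ) : Ω → WithTop ℕ :=
  hittingAfter (walk X y) (Set.Ioi y) 1

/-- The first strict ascending ladder time `τ₊ = inf {n > 0 : Sₙ > 0}`. -/
noncomputable def ladderTime {Ω : Type*} (X : ℕ → Ω → ℝ) : Ω → WithTop ℕ :=
  hittingAfter (walk X 0) (Set.Ioi 0) 1

/-- `φ(y) = E_y ρ^{τ_y} g(Y_{τ_y})`. -/
noncomputable def phi {Ω : Type*} {m : MeasurableSpace Ω} (P : Measure Ω)
    (X : ℕ → Ω → ℝ) (ρ : ℝ) (g : ℝ → ℝ) (y : ℝ) : ℝ≥0∞ :=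
  expectedReward P ρ g (walk X y) (exceedTime X y)

/-- `α* = inf {z > b : φ(z) ≤ g(z)}`, taken in `[-∞, ∞]`. -/
noncomputable def alphaStar {Ω : Type*} {m : MeasurableSpace Ω} (P : Measure Ω)
    (X : ℕ → Ω → ℝ) (ρ : ℝ) (g : ℝ → ℝ) (b : EReal) : EReal :=
  sInf ((fun z : ℝ => (z : EReal)) ''
    {z : ℝ | b < z ∧ phi P X ρ g z ≤ ENNReal.ofReal (g z)})

/-- `f(y) = (g(y) - φ(y)) / (1 - E_y ρ^{τ_y})`, with `ρ^∞ = 0` also for `ρ = 1`. -/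
noncomputable def fFun {Ω : Type*} {m : MeasurableSpace Ω} (P : Measure Ω)
    (X : ℕ → Ω → ℝ) (ρ : ℝ) (g : ℝ → ℝ) (y : ℝ) : ℝ :=
  1 / (1 - (expectedReward P ρ (fun _ => 1) (walk X y) (exceedTime X y)).toReal) *
    (g y - (phi P X ρ g y).toReal)

end LadderStopping

/-! The value function is written as an expected discounted sum over ladder epochs. Let `L h(y) = E
ρ^τ₊ h(y + S_τ₊)`, so that `φ = L g`. Let `A` be the candidate stopping half-line, `κ = g - L g` on
`A` and `κ = 0` off `A`, and let `w(y)` be the expectation of `∑ ρⁿ κ(Yₙ)` over the ladder epochs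
`n`, including `n = 0`.

Log-concavity makes `φ/g` decreasing above `α*`. Together with the monotonicity of `g`, this makes
`κ` increasing, and then `w` is superharmonic (`recordPotential_superharmonic`). Iterating `g ≤ κ +
L g`, with a remainder killed by (Opt), gives `g ≤ w` (`le_recordPotential`); minimality of `w`
gives `w = g` on `A` (`recordPotential_le`). Optional stopping then yields `V ≤ w`. Conversely, `κ`
vanishes until the walk enters `A`, and that entrance is a ladder epoch, so restarting there shows
that the entrance time earns at least `w` (`recordPotential_le_stoppedReward_hitting`).
`exists_superharmonic_eq_value` assembles this; the sign of `f(α*)` decides whether `A` contains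
`α*`. -/

namespace LadderStopping

/-! ### Independence of past and future; the Markov property. -/

section Markov

variable {Ω : Type*} {m : MeasurableSpace Ω} {P : Measure Ω} {ℱ : Filtration ℕ m} {X : ℕ → Ω → ℝ}

lemma IsRandomWalk.measurable_of_lt (hX : IsRandomWalk P ℱ X) {i n : ℕ} (h : i < n) :
    Measurable[ℱ n] (X i) :=
  (hX.measurable_step i).mono (ℱ.mono h) le_rfl

lemma IsRandomWalk.measurable (hX : IsRandomWalk P ℱ X) (i : ℕ) : Measurable (X i) :=
  (hX.measurable_step i).mono (ℱ.le _) le_rfl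

lemma IsRandomWalk.measurable_walk (hX : IsRandomWalk P ℱ X) (y : ℝ) (n : ℕ) :
    Measurable[ℱ n] (walk X y n) := by
  unfold walk
  refine Measurable.const_add (Finset.measurable_fun_sum _ fun i hi => ?_) y
  exact hX.measurable_of_lt (Finset.mem_range.1 hi)

lemma IsRandomWalk.adapted_walk (hX : IsRandomWalk P ℱ X) (y : ℝ) : Adapted ℱ (walk X y) :=
  fun n => hX.measurable_walk y n

lemma IsRandomWalk.isStoppingTime_hittingAfter (hX : IsRandomWalk P ℱ X) (y : ℝ) {s : Set ℝ}
    (hs : MeasurableSet s) (n : ℕ) : IsStoppingTime ℱ (hittingAfter (walk X y) s n) :=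
  (hX.adapted_walk y).isStoppingTime_hittingAfter hs

/-- The induction peels off the last step, which is independent of everything before it;
measurability is carried along because the independence hypothesis requires it. -/
lemma IsRandomWalk.measure_inter_box [IsProbabilityMeasure P] (hX : IsRandomWalk P ℱ X) (k : ℕ)
    {E : Set Ω} (hE : MeasurableSet[ℱ k] E) {t : ℕ → Set ℝ} (ht : ∀ i, MeasurableSet (t i))
    (n : ℕ) :
    MeasurableSet[ℱ (k + n)] (E ∩ ⋂ i ∈ Finset.range n, X (k + i) ⁻¹' t i) ∧
    P (E ∩ ⋂ i ∈ Finset.range n, X (k + i) ⁻¹' t i)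
      = P E * ∏ i ∈ Finset.range n, P.map (X 0) (t i) := by
  induction n with
  | zero => simpa using hE
  | succ n ih =>
    have hset : E ∩ ⋂ i ∈ Finset.range (n + 1), X (k + i) ⁻¹' t i
        = (X (k + n) ⁻¹' t n) ∩ (E ∩ ⋂ i ∈ Finset.range n, X (k + i) ⁻¹' t i) := by
      rw [Finset.range_add_one, Finset.set_biInter_insert]
      rw [Set.inter_left_comm]
    rw [hset]
    refine ⟨?_, ?_⟩
    · exact ((hX.measurable_step (k + n)) (ht n)).inter (ℱ.mono (by omega) _ ih.1)
    · have h := (Indep_iff _ _ P).1 (hX.indep_past (k + n)) (X (k + n) ⁻¹' t n) _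
        ⟨t n, ht n, rfl⟩ ih.1
      rw [h, ih.2, Finset.prod_range_succ, ← Measure.map_apply (hX.measurable _) (ht n),
        (hX.identDistrib (k + n)).map_eq]
      ring

lemma IsRandomWalk.measurable_shift (hX : IsRandomWalk P ℱ X) (k : ℕ) :
    Measurable (fun ω i => X (k + i) ω) :=
  measurable_pi_lambda _ fun i => hX.measurable (k + i)

lemma IsRandomWalk.measurable_seq (hX : IsRandomWalk P ℱ X) :
    Measurable (fun ω i => X i ω) :=
  measurable_pi_lambda _ fun i => hX.measurable i

lemma IsRandomWalk.measure_inter_shift [IsProbabilityMeasure P] (hX : IsRandomWalk P ℱ X) (k : ℕ)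
    {E : Set Ω} (hE : MeasurableSet[ℱ k] E) {t : Set (ℕ → ℝ)} (ht : MeasurableSet t) :
    P (E ∩ (fun ω i => X (k + i) ω) ⁻¹' t)
      = P E * Measure.infinitePi (fun _ : ℕ => P.map (X 0)) t := by
  classical
  have : IsProbabilityMeasure (P.map (X 0)) :=
    Measure.isProbabilityMeasure_map (hX.measurable 0).aemeasurable
  have hE' : MeasurableSet E := ℱ.le k _ hE
  rcases eq_or_ne (P E) 0 with h0 | h0
  · rw [h0, zero_mul]
    exact measure_mono_null Set.inter_subset_left h0
  have : IsProbabilityMeasure (P[|E]) := cond_isProbabilityMeasure h0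
  -- Conditionally on `E`, the future steps have the product law: it suffices to compare finite
  -- boxes.
  have key : (P[|E]).map (fun ω i => X (k + i) ω)
      = Measure.infinitePi (fun _ : ℕ => P.map (X 0)) := by
    refine Measure.eq_infinitePi _ fun s u hu => ?_
    rw [Measure.map_apply (hX.measurable_shift k) (MeasurableSet.pi s.countable_toSet
      fun i _ => hu i), cond_apply hE']
    obtain ⟨n, hn⟩ := s.exists_nat_subset_range
    have h := (hX.measure_inter_box k hE (t := fun i => if i ∈ s then u i else Set.univ)
      (fun i => by split_ifs <;> [exact hu i; exact .univ]) n).2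
    have hset : E ∩ ⋂ i ∈ Finset.range n, X (k + i) ⁻¹' (if i ∈ s then u i else Set.univ)
        = E ∩ (fun ω i => X (k + i) ω) ⁻¹' (s : Set ℕ).pi u := by
      congr 1
      ext ω
      simp only [Set.mem_iInter, Set.mem_preimage, Set.mem_pi, Finset.mem_coe]
      constructor
      · intro h i hi
        simpa [hi] using h i (hn hi)
      · intro h i _
        by_cases hi : i ∈ s
        · simpa [hi] using h i hi
        · simp [hi]
    rw [← hset, h, ← mul_assoc, ENNReal.inv_mul_cancel h0 (measure_ne_top _ _), one_mul,
      ← Finset.prod_subset hn]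
    · exact Finset.prod_congr rfl fun i hi => by simp [hi]
    · intro i _ hi
      simp [hi]
  rw [← key, Measure.map_apply (hX.measurable_shift k) ht, cond_apply hE', ← mul_assoc,
    ENNReal.mul_inv_cancel h0 (measure_ne_top _ _), one_mul]

lemma IsRandomWalk.map_seq [IsProbabilityMeasure P] (hX : IsRandomWalk P ℱ X) :
    P.map (fun ω i => X i ω) = Measure.infinitePi (fun _ : ℕ => P.map (X 0)) := by
  ext t ht
  rw [Measure.map_apply hX.measurable_seq ht]
  simpa using hX.measure_inter_shift 0 (E := Set.univ) .univ ht

/-- The Markov property at a fixed time. -/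
lemma IsRandomWalk.lintegral_markov [IsProbabilityMeasure P] (hX : IsRandomWalk P ℱ X) (k : ℕ)
    {E : Set Ω} (hE : MeasurableSet[ℱ k] E) {z : Ω → ℝ} (hz : Measurable[ℱ k] z)
    {F : ℝ → (ℕ → ℝ) → ℝ≥0∞} (hF : Measurable (Function.uncurry F)) :
    ∫⁻ ω in E, F (z ω) (fun i => X (k + i) ω) ∂P
      = ∫⁻ ω in E, ∫⁻ ω', F (z ω) (fun i => X i ω') ∂P ∂P := by
  have : IsProbabilityMeasure (P.map (X 0)) :=
    Measure.isProbabilityMeasure_map (hX.measurable 0).aemeasurable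
  have hz' : Measurable z := hz.mono (ℱ.le k) le_rfl
  have key : (P.restrict E).map (fun ω => (z ω, fun i => X (k + i) ω))
      = ((P.restrict E).map z).prod (Measure.infinitePi (fun _ : ℕ => P.map (X 0))) := by
    symm
    refine Measure.prod_eq fun s t hs ht => ?_
    rw [Measure.map_apply (hz'.prodMk (hX.measurable_shift k)) (hs.prod ht),
      Measure.map_apply hz' hs, Measure.restrict_apply (hz' hs),
      Measure.restrict_apply ((hz'.prodMk (hX.measurable_shift k)) (hs.prod ht)),
      ← hX.measure_inter_shift k ((hz hs).inter hE) ht]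
    congr 1
    ext ω
    simp only [Set.mem_inter_iff, Set.mem_preimage, Set.mem_prod]
    tauto
  have h1 : ∫⁻ ω in E, F (z ω) (fun i => X (k + i) ω) ∂P
      = ∫⁻ p, Function.uncurry F p ∂((P.restrict E).map (fun ω => (z ω, fun i => X (k + i) ω))) :=
    (lintegral_map hF (hz'.prodMk (hX.measurable_shift k))).symm
  rw [h1, key, lintegral_prod _ hF.aemeasurable, lintegral_map hF.lintegral_prod_right' hz']
  refine lintegral_congr fun ω => ?_
  rw [← hX.map_seq]
  exact lintegral_map (f := fun x => Function.uncurry F (z ω, x))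
    (hF.comp measurable_prodMk_left) hX.measurable_seq

end Markov

/-! ### Stopped rewards and the strong Markov property. -/

section Stopped

variable {Ω : Type*} {m : MeasurableSpace Ω} {P : Measure Ω} {ℱ : Filtration ℕ m} {X : ℕ → Ω → ℝ}

/-- `E r^τ h(Y_τ)` for a `[0, ∞]`-valued function `h`, with value `0` where `τ = ∞`. -/
noncomputable def stoppedReward (P : Measure Ω) (X : ℕ → Ω → ℝ) (r : ℝ≥0∞) (h : ℝ → ℝ≥0∞)
    (τ : Ω → WithTop ℕ) (y : ℝ) : ℝ≥0∞ :=
  ∑' n : ℕ, ∫⁻ ω in {ω | τ ω = n}, r ^ n * h (walk X y n ω) ∂P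

lemma _root_.MeasureTheory.IsStoppingTime.measurableSet_eq_coe {τ : Ω → WithTop ℕ}
    (hτ : IsStoppingTime ℱ τ) (n : ℕ) : MeasurableSet[ℱ n] {ω | τ ω = n} :=
  hτ.measurableSet_eq n

lemma lintegral_eq_tsum_stopping {τ : Ω → WithTop ℕ} (hτ : IsStoppingTime ℱ τ) (h : Ω → ℝ≥0∞) :
    ∫⁻ ω, h ω ∂P = ∑' n : ℕ, ∫⁻ ω in {ω | τ ω = n}, h ω ∂P + ∫⁻ ω in {ω | τ ω = ⊤}, h ω ∂P := by
  have hm : ∀ n : ℕ, MeasurableSet {ω | τ ω = n} := fun n => ℱ.le n _ (hτ.measurableSet_eq_coe n)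
  have hU : (⋃ n : ℕ, {ω | τ ω = n})ᶜ = {ω | τ ω = ⊤} := by
    ext ω
    simp only [Set.mem_compl_iff, Set.mem_iUnion, Set.mem_ofPred_eq, not_exists]
    constructor
    · intro h
      by_contra hne
      obtain ⟨k, hk⟩ := WithTop.ne_top_iff_exists.1 hne
      exact h k hk.symm
    · intro h n
      simp [h]
  rw [← lintegral_iUnion hm, ← hU, lintegral_add_compl _ (MeasurableSet.iUnion hm)]
  intro i j hij
  refine Set.disjoint_left.2 fun ω hi hj => hij ?_
  have : ((i : ℕ) : WithTop ℕ) = j := hi.symm.trans hj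
  exact_mod_cast this

lemma expectedReward_eq_stoppedReward {τ : Ω → WithTop ℕ} (hτ : IsStoppingTime ℱ τ) {ρ : ℝ}
    (hρ : 0 ≤ ρ) (g : ℝ → ℝ) (y : ℝ) :
    expectedReward P ρ g (walk X y) τ
      = stoppedReward P X (ENNReal.ofReal ρ) (fun z => ENNReal.ofReal (g z)) τ y := by
  have hm : ∀ n : ℕ, MeasurableSet {ω | τ ω = n} := fun n => ℱ.le n _ (hτ.measurableSet_eq_coe n)
  have htop : MeasurableSet {ω | τ ω = ⊤} := by
    have : {ω | τ ω = ⊤} = (⋃ n : ℕ, {ω | τ ω = n})ᶜ := by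
      ext ω
      simp only [Set.mem_compl_iff, Set.mem_iUnion, Set.mem_ofPred_eq, not_exists]
      cases τ ω <;> simp
    rw [this]
    exact (MeasurableSet.iUnion hm).compl
  unfold expectedReward stoppedReward
  rw [lintegral_eq_tsum_stopping hτ, setLIntegral_congr_fun (g := fun _ => 0) htop, lintegral_zero,
    add_zero]
  · refine tsum_congr fun n => setLIntegral_congr_fun (hm n) fun ω hω => ?_
    have h : τ ω = n := hω
    simp only [discountedReward]
    rw [h]
    simp [ENNReal.ofReal_mul (pow_nonneg hρ n), ENNReal.ofReal_pow hρ]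
  · intro ω hω
    have h : τ ω = ⊤ := hω
    simp only [discountedReward]
    rw [h]
    simp

lemma stoppedReward_mono {r : ℝ≥0∞} {h₁ h₂ : ℝ → ℝ≥0∞} {τ : Ω → WithTop ℕ}
    (hτ : IsStoppingTime ℱ τ) {y : ℝ}
    (h : ∀ ω, ∀ n : ℕ, τ ω = n → h₁ (walk X y n ω) ≤ h₂ (walk X y n ω)) :
    stoppedReward P X r h₁ τ y ≤ stoppedReward P X r h₂ τ y :=
  ENNReal.tsum_le_tsum fun n => setLIntegral_mono' (ℱ.le n _ (hτ.measurableSet_eq_coe n))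
    fun ω hω => by gcongr; exact h ω n hω

lemma stoppedReward_add (hX : IsRandomWalk P ℱ X) {r : ℝ≥0∞} {h₁ h₂ : ℝ → ℝ≥0∞}
    (hh₁ : Measurable h₁) {τ : Ω → WithTop ℕ} {y : ℝ} :
    stoppedReward P X r (fun z => h₁ z + h₂ z) τ y
      = stoppedReward P X r h₁ τ y + stoppedReward P X r h₂ τ y := by
  unfold stoppedReward
  rw [← ENNReal.tsum_add]
  refine tsum_congr fun n => ?_
  have hw : Measurable (walk X y n) := (hX.measurable_walk y n).mono (ℱ.le n) le_rfl
  simp only [mul_add]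
  exact lintegral_add_left ((hh₁.comp hw).const_mul _) _

/-- The strong Markov property. -/
lemma stoppedReward_lintegral [IsProbabilityMeasure P] (hX : IsRandomWalk P ℱ X) (r : ℝ≥0∞)
    {τ : Ω → WithTop ℕ} (hτ : IsStoppingTime ℱ τ)
    {F : ℝ → (ℕ → ℝ) → ℝ≥0∞} (hF : Measurable (Function.uncurry F)) (y : ℝ) :
    stoppedReward P X r (fun z => ∫⁻ ω, F z (fun i => X i ω) ∂P) τ y
      = ∑' n : ℕ, ∫⁻ ω in {ω | τ ω = n}, r ^ n * F (walk X y n ω) (fun i => X (n + i) ω) ∂P := by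
  refine tsum_congr fun n => ?_
  rw [hX.lintegral_markov n (hτ.measurableSet_eq_coe n) (hX.measurable_walk y n)
    (F := fun z x => r ^ n * F z x) (hF.const_mul _)]
  refine lintegral_congr fun ω => ?_
  rw [lintegral_const_mul]
  exact (hF.comp measurable_prodMk_left).comp hX.measurable_seq

end Stopped

/-! ### Deterministic facts about ladder epochs of a path. -/

section Records

/-- `Sₙ = x₀ + ⋯ + xₙ₋₁`. -/
def partialSum (x : ℕ → ℝ) (n : ℕ) : ℝ := ∑ i ∈ Finset.range n, x i

/-- `n` is a strict ascending ladder epoch (`0` included). -/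
def IsRecord (x : ℕ → ℝ) (n : ℕ) : Prop := ∀ j < n, partialSum x j < partialSum x n

open Classical in
/-- The contribution of time `n` to the discounted sum over the ladder epochs. -/
noncomputable def recordTerm (r : ℝ≥0∞) (κ : ℝ → ℝ≥0∞) (y : ℝ) (x : ℕ → ℝ) (n : ℕ) : ℝ≥0∞ :=
  if IsRecord x n then r ^ n * κ (y + partialSum x n) else 0

/-- The discounted sum `∑ r^n κ(y + Sₙ)` over the ladder epochs `n`. -/
noncomputable def recordSum (r : ℝ≥0∞) (κ : ℝ → ℝ≥0∞) (y : ℝ) (x : ℕ → ℝ) : ℝ≥0∞ :=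
  ∑' n, recordTerm r κ y x n

lemma partialSum_add (x : ℕ → ℝ) (k n : ℕ) :
    partialSum x (k + n) = partialSum x k + partialSum (fun i => x (k + i)) n :=
  Finset.sum_range_add _ _ _

lemma walk_eq {Ω : Type*} (X : ℕ → Ω → ℝ) (y : ℝ) (n : ℕ) (ω : Ω) :
    walk X y n ω = y + partialSum (fun i => X i ω) n := rfl

/-- Since `k` already beats all earlier times, a later epoch only has to compete with the times from
`k` on. -/
lemma IsRecord.add_iff {x : ℕ → ℝ} {k : ℕ} (hk : IsRecord x k) (n : ℕ) :
    IsRecord x (k + n) ↔ IsRecord (fun i => x (k + i)) n := by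
  constructor
  · intro h j hj
    have := h (k + j) (by omega)
    rw [partialSum_add, partialSum_add] at this
    linarith
  · intro h j hj
    have h0 : partialSum x k ≤ partialSum x (k + n) := by
      rw [partialSum_add]
      rcases Nat.eq_zero_or_pos n with rfl | hn
      · simp [partialSum]
      · have := h 0 hn
        simp only [partialSum, Finset.range_zero, Finset.sum_empty] at this ⊢
        linarith
    rcases lt_or_ge j k with hjk | hjk
    · exact (hk j hjk).trans_le h0
    · obtain ⟨i, rfl⟩ := Nat.exists_eq_add_of_le hjk
      have := h i (by omega)
      rw [partialSum_add, partialSum_add]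
      linarith

lemma recordTerm_add {r : ℝ≥0∞} {κ : ℝ → ℝ≥0∞} {y : ℝ} {x : ℕ → ℝ} {k : ℕ} (hk : IsRecord x k)
    (n : ℕ) : recordTerm r κ y x (k + n)
      = r ^ k * recordTerm r κ (y + partialSum x k) (fun i => x (k + i)) n := by
  unfold recordTerm
  rw [partialSum_add, pow_add, ← add_assoc, mul_assoc]
  by_cases h : IsRecord x (k + n)
  · rw [if_pos h, if_pos ((hk.add_iff n).1 h)]
  · rw [if_neg h, if_neg (fun h' => h ((hk.add_iff n).2 h')), mul_zero]

lemma recordTerm_zero (r : ℝ≥0∞) (κ : ℝ → ℝ≥0∞) (y : ℝ) (x : ℕ → ℝ) :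
    recordTerm r κ y x 0 = κ y := by
  have : IsRecord x 0 := fun j hj => absurd hj (by omega)
  simp [recordTerm, this, partialSum]

lemma recordSum_eq_add (r : ℝ≥0∞) (κ : ℝ → ℝ≥0∞) (y : ℝ) (x : ℕ → ℝ) :
    recordSum r κ y x = κ y + ∑' n, recordTerm r κ y x (n + 1) := by
  rw [recordSum, tsum_eq_zero_add' ENNReal.summable, recordTerm_zero]

/-- Restarting the walk at a ladder epoch `k ≥ 1`. -/
lemma mul_recordSum_le_tsum_succ {r : ℝ≥0∞} {κ : ℝ → ℝ≥0∞} {y : ℝ} {x : ℕ → ℝ} {k : ℕ}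
    (hk : IsRecord x k) (hk1 : 1 ≤ k) :
    r ^ k * recordSum r κ (y + partialSum x k) (fun i => x (k + i))
      ≤ ∑' n, recordTerm r κ y x (n + 1) := by
  obtain ⟨j, rfl⟩ := Nat.exists_eq_add_of_le' hk1
  unfold recordSum
  rw [← ENNReal.tsum_mul_left]
  simp_rw [← recordTerm_add hk]
  have := ENNReal.tsum_comp_le_tsum_of_injective (f := fun n : ℕ => j + n)
    (fun a b h => by simpa using h) (fun n => recordTerm r κ y x (n + 1))
  refine le_trans (le_of_eq ?_) this
  exact tsum_congr fun n => by rw [add_right_comm]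

/-- No record lies strictly between `0` and the first ladder epoch `k`, so every record in `[1, N]`
lies in `[k, k + N)`. The truncated sums serve the induction in `recordPotential_le`. -/
lemma sum_recordTerm_succ_le {r : ℝ≥0∞} {κ : ℝ → ℝ≥0∞} {y : ℝ} {x : ℕ → ℝ} {k : ℕ}
    (hk : IsRecord x k) (hk1 : 1 ≤ k) (hfirst : ∀ j, 1 ≤ j → j < k → ¬ 0 < partialSum x j) (N : ℕ) :
    ∑ n ∈ Finset.range N, recordTerm r κ y x (n + 1)
      ≤ r ^ k * ∑ n ∈ Finset.range N,
        recordTerm r κ (y + partialSum x k) (fun i => x (k + i)) n := by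
  rw [Finset.mul_sum]
  simp_rw [← recordTerm_add hk]
  have h1 : ∑ n ∈ Finset.range N, recordTerm r κ y x (n + 1)
      = ∑ n ∈ Finset.Ico 1 (N + 1), recordTerm r κ y x n := by
    rw [Finset.sum_Ico_eq_sum_range]
    simp [add_comm]
  have h2 : ∑ n ∈ Finset.range N, recordTerm r κ y x (k + n)
      = ∑ n ∈ Finset.Ico k (k + N), recordTerm r κ y x n := by
    rw [Finset.sum_Ico_eq_sum_range]
    simp
  rw [h1, h2]
  refine Finset.sum_le_sum_of_ne_zero fun n hn hne => ?_
  rw [Finset.mem_Ico] at hn ⊢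
  refine ⟨?_, by omega⟩
  by_contra hlt
  have hrec : IsRecord x n := by
    by_contra h
    exact hne (by simp [recordTerm, h])
  have := hrec 0 (by omega)
  exact hfirst n hn.1 (by omega) (by simpa [partialSum] using this)

lemma recordTerm_succ_eq_zero {r : ℝ≥0∞} {κ : ℝ → ℝ≥0∞} {y : ℝ} {x : ℕ → ℝ} {n : ℕ}
    (h : ¬ 0 < partialSum x (n + 1)) : recordTerm r κ y x (n + 1) = 0 := by
  have : ¬ IsRecord x (n + 1) := fun hr => h (by simpa [partialSum] using hr 0 (by omega))
  simp [recordTerm, this]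

lemma recordTerm_eq_zero {r : ℝ≥0∞} {κ : ℝ → ℝ≥0∞} {y : ℝ} {x : ℕ → ℝ} {n : ℕ}
    (h : κ (y + partialSum x n) = 0) : recordTerm r κ y x n = 0 := by
  simp [recordTerm, h]

/-- Restarting the walk at the entrance time `k` into an upper set carrying `κ`. -/
lemma recordSum_eq_mul_of_entrance {r : ℝ≥0∞} {κ : ℝ → ℝ≥0∞} {A : Set ℝ} (hA : IsUpperSet A)
    (hκ : ∀ z ∉ A, κ z = 0) {y : ℝ} {x : ℕ → ℝ} {k : ℕ} (hkA : y + partialSum x k ∈ A)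
    (hfirst : ∀ j < k, y + partialSum x j ∉ A) :
    recordSum r κ y x = r ^ k * recordSum r κ (y + partialSum x k) (fun i => x (k + i)) := by
  have hk : IsRecord x k := by
    intro j hj
    by_contra h
    exact hfirst j hj (hA (by linarith) hkA)
  unfold recordSum
  rw [← ENNReal.tsum_mul_left]
  simp_rw [← recordTerm_add hk]
  rw [← ENNReal.summable.sum_add_tsum_nat_add' (f := recordTerm r κ y x) (k := k),
    Finset.sum_eq_zero, zero_add]
  · exact tsum_congr fun n => by rw [add_comm]
  · intro j hj
    exact recordTerm_eq_zero (hκ _ (hfirst j (Finset.mem_range.1 hj)))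

lemma measurable_partialSum (n : ℕ) : Measurable (fun x : ℕ → ℝ => partialSum x n) :=
  Finset.measurable_fun_sum _ fun i _ => measurable_pi_apply i

lemma measurableSet_isRecord (n : ℕ) : MeasurableSet {x : ℕ → ℝ | IsRecord x n} := by
  have : {x : ℕ → ℝ | IsRecord x n}
      = ⋂ j ∈ Finset.range n, {x | partialSum x j < partialSum x n} := by
    ext x
    simp [IsRecord]
  rw [this]
  exact Finset.measurableSet_biInter _ fun j _ =>
    measurableSet_lt (measurable_partialSum j) (measurable_partialSum n)

lemma measurable_recordTerm (r : ℝ≥0∞) {κ : ℝ → ℝ≥0∞} (hκ : Measurable κ) (n : ℕ) :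
    Measurable (Function.uncurry fun y x => recordTerm r κ y x n) := by
  refine Measurable.ite ((measurableSet_isRecord n).preimage measurable_snd) ?_ measurable_const
  exact (hκ.comp (measurable_fst.add ((measurable_partialSum n).comp measurable_snd))).const_mul _

lemma measurable_recordSum (r : ℝ≥0∞) {κ : ℝ → ℝ≥0∞} (hκ : Measurable κ) :
    Measurable (Function.uncurry fun y x => recordSum r κ y x) :=
  Measurable.tsum (f := fun n p => Function.uncurry (fun y x => recordTerm r κ y x n) p)
    fun n => measurable_recordTerm r hκ n

end Records

/-! ### Pathwise description of the first ladder time. -/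

section LadderTime

variable {Ω : Type*} {X : ℕ → Ω → ℝ}

lemma hittingAfter_eq_coe {y : ℝ} {s : Set ℝ} {k n : ℕ} {ω : Ω}
    (h : hittingAfter (walk X y) s k ω = n) :
    k ≤ n ∧ walk X y n ω ∈ s ∧ ∀ j, k ≤ j → j < n → walk X y j ω ∉ s := by
  refine ⟨?_, ?_, ?_⟩
  · have := le_hittingAfter (u := walk X y) (s := s) (n := k) ω
    rw [h] at this
    exact WithTop.coe_le_coe.1 this
  · have := hittingAfter_mem_set_of_ne_top (u := walk X y) (s := s) (n := k) (ω := ω) (by simp [h])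
    rw [h] at this
    exact this
  · intro j hkj hjn
    exact notMem_of_lt_hittingAfter (by rw [h]; exact WithTop.coe_lt_coe.2 hjn) hkj

lemma ladderTime_eq_coe {n : ℕ} {ω : Ω} (h : ladderTime X ω = n) :
    1 ≤ n ∧ 0 < partialSum (fun i => X i ω) n ∧
      (∀ j, 1 ≤ j → j < n → ¬ 0 < partialSum (fun i => X i ω) j) ∧
      IsRecord (fun i => X i ω) n := by
  obtain ⟨h1, h2, h3⟩ := hittingAfter_eq_coe h
  simp only [walk_eq, zero_add, Set.mem_Ioi] at h2 h3
  refine ⟨h1, h2, h3, fun j hj => ?_⟩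
  rcases Nat.eq_zero_or_pos j with rfl | hj0
  · simpa [partialSum] using h2
  · exact (not_lt.1 (h3 j hj0 hj)).trans_lt h2

lemma ladderTime_eq_top {ω : Ω} (h : ladderTime X ω = ⊤) (n : ℕ) :
    ¬ 0 < partialSum (fun i => X i ω) (n + 1) := by
  have := hittingAfter_eq_top_iff.1 h (n + 1) (by omega)
  simpa [walk_eq] using this

lemma exceedTime_eq_ladderTime (X : ℕ → Ω → ℝ) (y : ℝ) : exceedTime X y = ladderTime X := by
  funext ω
  have h : ∀ j, walk X y j ω ∈ Set.Ioi y ↔ walk X 0 j ω ∈ Set.Ioi 0 := fun j => by simp [walk]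
  unfold exceedTime ladderTime hittingAfter
  congr! 3
  · exact and_congr_right fun _ => h _
  · exact Set.ext fun j => and_congr_right fun _ => h j

end LadderTime

/-! ### The ladder potential `w`: fixed-point inequalities and superharmonicity. -/

section Potential

variable {Ω : Type*} {m : MeasurableSpace Ω} {P : Measure Ω} {ℱ : Filtration ℕ m} {X : ℕ → Ω → ℝ}
  {r : ℝ≥0∞} {κ : ℝ → ℝ≥0∞}

/-- The discounted ladder height operator `h ↦ E r^τ₊ h(y + S_τ₊)`. -/
noncomputable def ladderOp (P : Measure Ω) (X : ℕ → Ω → ℝ) (r : ℝ≥0∞) (h : ℝ → ℝ≥0∞) (y : ℝ) :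
    ℝ≥0∞ :=
  stoppedReward P X r h (ladderTime X) y

/-- The expected discounted sum of `κ` over the ladder epochs of the walk started at `y`. -/
noncomputable def recordPotential (P : Measure Ω) (X : ℕ → Ω → ℝ) (r : ℝ≥0∞) (κ : ℝ → ℝ≥0∞)
    (y : ℝ) : ℝ≥0∞ :=
  ∫⁻ ω, recordSum r κ y (fun i => X i ω) ∂P

lemma IsRandomWalk.isStoppingTime_ladderTime (hX : IsRandomWalk P ℱ X) :
    IsStoppingTime ℱ (ladderTime X) :=
  hX.isStoppingTime_hittingAfter 0 measurableSet_Ioi 1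

lemma ladderOp_mono (hX : IsRandomWalk P ℱ X) {h₁ h₂ : ℝ → ℝ≥0∞} {y : ℝ}
    (h : ∀ z, y < z → h₁ z ≤ h₂ z) : ladderOp P X r h₁ y ≤ ladderOp P X r h₂ y := by
  refine stoppedReward_mono hX.isStoppingTime_ladderTime fun ω n hn => h _ ?_
  rw [walk_eq]
  linarith [(ladderTime_eq_coe hn).2.1]

lemma IsRandomWalk.measurable_recordTerm_seq (hX : IsRandomWalk P ℱ X) (r : ℝ≥0∞)
    (hκ : Measurable κ) (y : ℝ) (n : ℕ) :
    Measurable fun ω => recordTerm r κ y (fun i => X i ω) n :=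
  ((measurable_recordTerm r hκ n).comp measurable_prodMk_left).comp hX.measurable_seq

lemma IsRandomWalk.measurable_lintegral_seq [IsProbabilityMeasure P] (hX : IsRandomWalk P ℱ X)
    {F : ℝ → (ℕ → ℝ) → ℝ≥0∞} (hF : Measurable (Function.uncurry F)) :
    Measurable fun y => ∫⁻ ω, F y (fun i => X i ω) ∂P := by
  have h : Measurable fun p : ℝ × Ω => F p.1 (fun i => X i p.2) :=
    hF.comp (measurable_fst.prodMk (hX.measurable_seq.comp measurable_snd))
  exact h.lintegral_prod_right'

lemma measurable_recordPotential [IsProbabilityMeasure P] (hX : IsRandomWalk P ℱ X)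
    (hκ : Measurable κ) : Measurable (recordPotential P X r κ) :=
  hX.measurable_lintegral_seq (measurable_recordSum r hκ)

lemma recordPotential_eq_add [IsProbabilityMeasure P] (y : ℝ) :
    recordPotential P X r κ y
      = κ y + ∫⁻ ω, ∑' n, recordTerm r κ y (fun i => X i ω) (n + 1) ∂P := by
  unfold recordPotential
  simp_rw [recordSum_eq_add]
  rw [lintegral_add_left measurable_const]
  simp

lemma add_ladderOp_recordPotential_le [IsProbabilityMeasure P] (hX : IsRandomWalk P ℱ X)
    (hκ : Measurable κ) (y : ℝ) :
    κ y + ladderOp P X r (recordPotential P X r κ) y ≤ recordPotential P X r κ y := by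
  have hτ := hX.isStoppingTime_ladderTime
  rw [recordPotential_eq_add]
  gcongr
  refine (stoppedReward_lintegral hX r hτ (measurable_recordSum r hκ) y).trans_le ?_
  rw [lintegral_eq_tsum_stopping hτ]
  refine le_add_right (ENNReal.tsum_le_tsum fun n => ?_)
  refine setLIntegral_mono' (ℱ.le n _ (hτ.measurableSet_eq_coe n)) fun ω hω => ?_
  obtain ⟨h1, -, -, h2⟩ := ladderTime_eq_coe hω
  exact mul_recordSum_le_tsum_succ h2 h1

/-- `recordPotential κ` is the least solution of `κ + ladderOp h ≤ h`. -/
lemma recordPotential_le [IsProbabilityMeasure P] (hX : IsRandomWalk P ℱ X)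
    (hκ : Measurable κ) {h : ℝ → ℝ≥0∞} (hh : ∀ y, κ y + ladderOp P X r h y ≤ h y) (y : ℝ) :
    recordPotential P X r κ y ≤ h y := by
  have hτ := hX.isStoppingTime_ladderTime
  -- Truncation makes induction possible: `N + 1` terms are bounded by `κ y` plus `N` terms of the
  -- walk restarted at the first ladder time. Where that time is infinite, only the term at `0`
  -- survives.
  have key : ∀ N y, ∫⁻ ω, ∑ n ∈ Finset.range N, recordTerm r κ y (fun i => X i ω) n ∂P ≤ h y := by
    intro N
    induction N with
    | zero => simp
    | succ N ih =>
      intro y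
      refine le_trans ?_ (hh y)
      simp_rw [Finset.sum_range_succ', recordTerm_zero]
      rw [lintegral_add_right _ measurable_const, add_comm]
      simp only [lintegral_const, measure_univ, mul_one]
      gcongr
      have hF : Measurable (Function.uncurry
          fun y x => ∑ n ∈ Finset.range N, recordTerm r κ y x n) :=
        Finset.measurable_fun_sum _ fun n _ => measurable_recordTerm r hκ n
      refine le_trans ?_ (ladderOp_mono hX (h₁ := fun y =>
        ∫⁻ ω, ∑ n ∈ Finset.range N, recordTerm r κ y (fun i => X i ω) n ∂P) fun z _ => ih z)
      refine le_trans ?_ (stoppedReward_lintegral hX r hτ hF y).ge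
      rw [lintegral_eq_tsum_stopping hτ, setLIntegral_congr_fun (g := fun _ => 0)
        (s := {ω | ladderTime X ω = ⊤}), lintegral_zero, add_zero]
      · refine ENNReal.tsum_le_tsum fun n => ?_
        refine setLIntegral_mono' (ℱ.le n _ (hτ.measurableSet_eq_coe n)) fun ω hω => ?_
        obtain ⟨h1, -, h3, h2⟩ := ladderTime_eq_coe hω
        exact sum_recordTerm_succ_le h2 h1 h3 N
      · exact hτ.measurableSet_eq_top
      · intro ω hω
        exact Finset.sum_eq_zero fun n _ => recordTerm_succ_eq_zero (ladderTime_eq_top hω n)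
  unfold recordPotential recordSum
  simp_rw [ENNReal.tsum_eq_iSup_nat]
  rw [lintegral_iSup]
  · exact iSup_le fun N => key N y
  · exact fun N => Finset.measurable_fun_sum _ fun n _ => hX.measurable_recordTerm_seq r hκ y n
  · intro N M hNM ω
    exact Finset.sum_le_sum_of_subset (Finset.range_mono hNM)

lemma ladderOp_const_mul (hX : IsRandomWalk P ℱ X) {h : ℝ → ℝ≥0∞} (hh : Measurable h)
    (c : ℝ≥0∞) (y : ℝ) :
    ladderOp P X r (fun z => c * h z) y = c * ladderOp P X r h y := by
  unfold ladderOp stoppedReward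
  rw [← ENNReal.tsum_mul_left]
  refine tsum_congr fun n => ?_
  have hw : Measurable (walk X y n) := (hX.measurable_walk y n).mono (ℱ.le n) le_rfl
  rw [← lintegral_const_mul c (f := fun ω => r ^ n * h (walk X y n ω)) ((hh.comp hw).const_mul _)]
  exact lintegral_congr fun ω => by rw [mul_left_comm]

/-- The constant `(1 - q)⁻¹` solves `1 + q c = c`, and the potential is the least supersolution. -/
lemma recordPotential_one_ne_top [IsProbabilityMeasure P] (hX : IsRandomWalk P ℱ X)
    (hq : ladderOp P X r (fun _ => 1) 0 < 1) : recordPotential P X r (fun _ => 1) 0 ≠ ∞ := by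
  set q := ladderOp P X r (fun _ => 1) 0 with hq_def
  have hq' : ∀ y, ladderOp P X r (fun _ => 1) y = q := fun y => rfl
  have hq0 : 1 - q ≠ 0 := (tsub_pos_of_lt hq).ne'
  have hqt : 1 - q ≠ ∞ := ENNReal.sub_ne_top ENNReal.one_ne_top
  have h : recordPotential P X r (fun _ => 1) 0 ≤ (1 - q)⁻¹ := by
    refine recordPotential_le hX measurable_const (h := fun _ => (1 - q)⁻¹) (fun y => ?_) 0
    have h1 := ladderOp_const_mul (P := P) (r := r) hX (h := fun _ => 1) measurable_const
      (1 - q)⁻¹ y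
    simp only [mul_one] at h1
    rw [h1, hq']
    nth_rw 1 [← ENNReal.inv_mul_cancel hq0 hqt]
    rw [← mul_add, tsub_add_cancel_of_le hq.le, mul_one]
  exact ne_top_of_le_ne_top (ENNReal.inv_ne_top.2 hq0) h

/-- The discounted contribution of time `n + 1` to the ladder sums of the walk observed from
time `1` on. -/
lemma mul_recordTerm_shift_le {x : ℕ → ℝ} {y : ℝ} (hκ : Monotone κ) (n : ℕ) :
    r * recordTerm r κ (y + partialSum x 1) (fun i => x (1 + i)) n
      ≤ recordTerm r κ y x (n + 1)
        + κ y * (r * recordTerm r (fun _ => 1) 0 (fun i => x (1 + i)) n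
          - recordTerm r (fun _ => 1) 0 x (n + 1)) := by
  by_cases h : IsRecord (fun i => x (1 + i)) n
  · by_cases h' : IsRecord x (n + 1)
    · refine le_add_right (le_of_eq ?_)
      simp only [recordTerm, h, h', if_true]
      rw [add_assoc, ← partialSum_add, add_comm 1 n, pow_succ', mul_assoc]
    -- A record of the path seen from time `1` can fail to be a record of the whole path only
    -- against time `0`; then the position is at most `y` and monotonicity of `κ` bounds its
    -- contribution by `κ y`.
    · have hle : partialSum x (n + 1) ≤ 0 := by
        by_contra hpos
        push Not at hpos
        refine h' fun j hj => ?_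
        rcases Nat.eq_zero_or_pos j with rfl | hj0
        · simpa [partialSum] using hpos
        · obtain ⟨i, rfl⟩ := Nat.exists_eq_add_of_le hj0
          have := h i (by omega)
          rw [add_comm n 1]
          change partialSum x (1 + i) < _
          rw [partialSum_add, partialSum_add]
          linarith
      simp only [recordTerm, h, h', if_true, if_false, zero_add, mul_one, tsub_zero]
      rw [add_assoc, ← partialSum_add, add_comm 1 n, mul_comm (κ y), ← mul_assoc]
      gcongr
      exact hκ (by linarith)
  · simp [recordTerm, h]

/-- Records after time `0` remain records when time `0` is forgotten, so the truncated subtraction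
that counts the extra records is a true difference. -/
lemma recordTerm_one_le_shift {x : ℕ → ℝ} (n : ℕ) :
    recordTerm r (fun _ => 1) 0 x (n + 1)
      ≤ r * recordTerm r (fun _ => 1) 0 (fun i => x (1 + i)) n := by
  by_cases h' : IsRecord x (n + 1)
  · have h : IsRecord (fun i => x (1 + i)) n := by
      intro j hj
      have := h' (1 + j) (by omega)
      rw [add_comm n 1, partialSum_add, partialSum_add] at this
      linarith
    simp [recordTerm, h, h', pow_succ']
  · simp [recordTerm, h']

lemma IsRandomWalk.lintegral_markov_one [IsProbabilityMeasure P] (hX : IsRandomWalk P ℱ X)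
    (hκ : Measurable κ) (y : ℝ) :
    ∫⁻ ω, recordPotential P X r κ (y + X 0 ω) ∂P
      = ∫⁻ ω, recordSum r κ (y + X 0 ω) (fun i => X (1 + i) ω) ∂P := by
  have h := hX.lintegral_markov 1 (E := Set.univ) .univ
    (z := fun ω => y + X 0 ω) ((hX.measurable_step 0).const_add y) (measurable_recordSum r hκ)
  simp only [Measure.restrict_univ] at h
  exact h.symm

/-- Taking one step before counting loses the term `κ y` and gains extra records, each at a level at
most `y`. Their expected discounted number `J` is at most `1`, so the gain is at most `κ y`. -/
lemma recordPotential_superharmonic [IsProbabilityMeasure P] (hX : IsRandomWalk P ℱ X)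
    (hr : r ≤ 1) (hq : ladderOp P X r (fun _ => 1) 0 < 1) (hκ : Measurable κ)
    (hκm : Monotone κ) (y : ℝ) :
    r * ∫⁻ ω, recordPotential P X r κ (y + X 0 ω) ∂P ≤ recordPotential P X r κ y := by
  have hseq : ∀ n, Measurable fun ω =>
      recordTerm r (fun _ => 1) 0 (fun i => X (1 + i) ω) n := fun n =>
    ((measurable_recordTerm r measurable_const n).comp
      (measurable_prodMk_left (x := (0 : ℝ)))).comp (hX.measurable_shift 1)
  have hseq0 : ∀ n, Measurable fun ω => recordTerm r (fun _ => 1) 0 (fun i => X i ω) n := fun n =>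
    hX.measurable_recordTerm_seq r measurable_const 0 n
  set J : ℝ≥0∞ := ∫⁻ ω, ∑' n, (r * recordTerm r (fun _ => 1) 0 (fun i => X (1 + i) ω) n
    - recordTerm r (fun _ => 1) 0 (fun i => X i ω) (n + 1)) ∂P with hJ
  have hJ1 : J ≤ 1 := by
    set C := recordPotential P X r (fun _ => 1) 0 with hC
    have hCtop : C ≠ ∞ := recordPotential_one_ne_top hX hq
    set T := ∫⁻ ω, ∑' n, recordTerm r (fun _ => 1) 0 (fun i => X i ω) (n + 1) ∂P with hT
    have hCT : C = 1 + T := recordPotential_eq_add 0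
    -- The path from time `1` has the law of the whole path, so its discounted record count has mean
    -- `r C`. With `C = 1 + T` and `r ≤ 1` this gives `T + J ≤ T + 1`; `T` is finite and cancels.
    have h1 : T + J = r * C := by
      have hconst : ∀ z x, recordSum r (fun _ => 1) z x = recordSum r (fun _ => 1) 0 x :=
        fun _ _ => rfl
      have h2 := hX.lintegral_markov_one (r := r) (κ := fun _ => 1) measurable_const 0
      have h3 : ∫⁻ ω, recordPotential P X r (fun _ => 1) (0 + X 0 ω) ∂P = C := by
        have : ∀ z, recordPotential P X r (fun _ => 1) z = C := fun _ => rfl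
        simp [this]
      rw [h3] at h2
      rw [h2, hT, hJ, ← lintegral_add_left (Measurable.tsum fun n => hseq0 (n + 1)),
        ← lintegral_const_mul]
      · refine lintegral_congr fun ω => ?_
        rw [hconst, recordSum, ← ENNReal.tsum_mul_left, ← ENNReal.tsum_add]
        exact tsum_congr fun n => add_tsub_cancel_of_le (recordTerm_one_le_shift n)
      · simp_rw [hconst]
        exact Measurable.tsum hseq
    have hTtop : T ≠ ∞ := fun h => hCtop (by rw [hCT, h]; simp)
    have h4 : T + J ≤ T + 1 := by
      rw [h1, add_comm, ← hCT]
      exact mul_le_of_le_one_left' hr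
    exact (ENNReal.add_le_add_iff_left hTtop).1 h4
  rw [hX.lintegral_markov_one hκ y, ← lintegral_const_mul, recordPotential_eq_add]
  · calc ∫⁻ ω, r * recordSum r κ (y + X 0 ω) (fun i => X (1 + i) ω) ∂P
        ≤ ∫⁻ ω, ((∑' n, recordTerm r κ y (fun i => X i ω) (n + 1))
          + κ y * ∑' n, (r * recordTerm r (fun _ => 1) 0 (fun i => X (1 + i) ω) n
            - recordTerm r (fun _ => 1) 0 (fun i => X i ω) (n + 1))) ∂P := by
          refine lintegral_mono fun ω => ?_
          rw [recordSum, ← ENNReal.tsum_mul_left, ← ENNReal.tsum_mul_left, ← ENNReal.tsum_add]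
          refine ENNReal.tsum_le_tsum fun n => ?_
          have := mul_recordTerm_shift_le (r := r) (x := fun i => X i ω) (y := y) hκm n
          simpa [partialSum] using this
      _ = (∫⁻ ω, ∑' n, recordTerm r κ y (fun i => X i ω) (n + 1) ∂P) + κ y * J := by
          rw [lintegral_add_left (Measurable.tsum fun n =>
            hX.measurable_recordTerm_seq r hκ y (n + 1)), lintegral_const_mul]
          exact Measurable.tsum fun n => ((hseq n).const_mul r).sub (hseq0 (n + 1))
      _ ≤ _ := by
          rw [add_comm]
          gcongr
          exact mul_le_of_le_one_right' hJ1
  · exact (measurable_recordSum r hκ).comp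
      (((hX.measurable 0).const_add y).prodMk (hX.measurable_shift 1))

end Potential

/-! ### Comparison of the potential with the reward and with stopped rewards. -/

section Verification

variable {Ω : Type*} {m : MeasurableSpace Ω} {P : Measure Ω} {ℱ : Filtration ℕ m} {X : ℕ → Ω → ℝ}
  {r : ℝ≥0∞}

/-- Optional stopping for a nonnegative superharmonic function. -/
lemma stoppedReward_le_of_superharmonic [IsProbabilityMeasure P] (hX : IsRandomWalk P ℱ X)
    {w : ℝ → ℝ≥0∞} (hw : Measurable w) (hsup : ∀ y, r * ∫⁻ ω, w (y + X 0 ω) ∂P ≤ w y)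
    {τ : Ω → WithTop ℕ} (hτ : IsStoppingTime ℱ τ) (y : ℝ) :
    stoppedReward P X r w τ y ≤ w y := by
  have hge : ∀ n : ℕ, MeasurableSet[ℱ n] {ω | (n : WithTop ℕ) < τ ω} := fun n => hτ.measurableSet_gt n
  -- The invariant keeps the mass not yet stopped. The event `τ ≥ N + 1` equals `τ > N`, which is
  -- known at time `N`, so the one-step inequality applies on it.
  have key : ∀ N : ℕ, ∑ n ∈ Finset.range N, ∫⁻ ω in {ω | τ ω = n}, r ^ n * w (walk X y n ω) ∂P
      + ∫⁻ ω in {ω | (N : WithTop ℕ) ≤ τ ω}, r ^ N * w (walk X y N ω) ∂P ≤ w y := by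
    intro N
    induction N with
    | zero => simp [walk]
    | succ N ih =>
      refine le_trans ?_ ih
      rw [Finset.sum_range_succ, add_assoc]
      gcongr
      have hsplit : {ω | (N : WithTop ℕ) ≤ τ ω} = {ω | τ ω = N} ∪ {ω | (N : WithTop ℕ) < τ ω} := by
        ext ω
        simp only [Set.mem_ofPred_eq, Set.mem_union]
        rw [le_iff_eq_or_lt, eq_comm]
      rw [hsplit, lintegral_union (ℱ.le N _ (hge N))
        (Set.disjoint_left.2 fun ω h1 h2 => by
          have h1' : τ ω = N := h1
          have h2' : (N : WithTop ℕ) < τ ω := h2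
          rw [h1'] at h2'
          exact lt_irrefl _ h2')]
      refine add_le_add le_rfl ?_
      have hset : {ω | ((N + 1 : ℕ) : WithTop ℕ) ≤ τ ω} = {ω | (N : WithTop ℕ) < τ ω} := by
        ext ω
        simp only [Set.mem_ofPred_eq]
        cases τ ω with
        | top => simp
        | coe k =>
          constructor
          · intro h
            exact WithTop.coe_lt_coe.2 (WithTop.coe_le_coe.1 h)
          · intro h
            exact WithTop.coe_le_coe.2 (WithTop.coe_lt_coe.1 h)
      rw [hset]
      have hF : Measurable (Function.uncurry
          fun (z : ℝ) (x : ℕ → ℝ) => r ^ (N + 1) * w (z + x 0)) :=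
        (hw.comp (measurable_fst.add ((measurable_pi_apply 0).comp measurable_snd))).const_mul _
      have hM := hX.lintegral_markov N (hge N) (hX.measurable_walk y N) hF
      have hleft : ∀ ω, walk X y (N + 1) ω = walk X y N ω + X (N + 0) ω := fun ω => by
        simp [walk, Finset.sum_range_succ, add_assoc]
      simp_rw [hleft]
      refine hM.trans_le (lintegral_mono fun ω => ?_)
      rw [lintegral_const_mul (r ^ (N + 1)) (f := fun ω' => w (walk X y N ω + X 0 ω'))
        (hw.comp ((hX.measurable 0).const_add _)), pow_succ, mul_assoc]
      gcongr
      exact hsup _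
  unfold stoppedReward
  rw [ENNReal.tsum_eq_iSup_nat]
  exact iSup_le fun N => le_trans le_self_add (key N)

/-- `E sup_{k ≥ n} r^k h(Y_k)`. -/
noncomputable def tailSup (P : Measure Ω) (X : ℕ → Ω → ℝ) (r : ℝ≥0∞) (h : ℝ → ℝ≥0∞) (n : ℕ)
    (y : ℝ) : ℝ≥0∞ :=
  ∫⁻ ω, ⨆ k, r ^ (n + k) * h (walk X y (n + k) ω) ∂P

lemma le_tailSup_zero [IsProbabilityMeasure P] (h : ℝ → ℝ≥0∞) (y : ℝ) :
    h y ≤ tailSup P X r h 0 y := by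
  have h1 : h y = ∫⁻ _, h y ∂P := by simp
  rw [h1]
  refine lintegral_mono fun ω => ?_
  refine le_trans ?_ (le_iSup _ 0)
  simp [walk]

/-- The ladder time is at least `1`, so `n` further steps end at time `n + 1` or later. -/
lemma ladderOp_tailSup_le [IsProbabilityMeasure P] (hX : IsRandomWalk P ℱ X) {h : ℝ → ℝ≥0∞}
    (hh : Measurable h) (n : ℕ) (y : ℝ) :
    ladderOp P X r (tailSup P X r h n) y ≤ tailSup P X r h (n + 1) y := by
  have hτ := hX.isStoppingTime_ladderTime
  have hF : Measurable (Function.uncurry fun (z : ℝ) (x : ℕ → ℝ) =>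
      ⨆ k, r ^ (n + k) * h (z + partialSum x (n + k))) :=
    Measurable.iSup fun k => (hh.comp (measurable_fst.add
      ((measurable_partialSum _).comp measurable_snd))).const_mul _
  refine (stoppedReward_lintegral hX r hτ hF y).trans_le ?_
  rw [tailSup, lintegral_eq_tsum_stopping hτ]
  refine le_add_right (ENNReal.tsum_le_tsum fun k => ?_)
  refine setLIntegral_mono' (ℱ.le k _ (hτ.measurableSet_eq_coe k)) fun ω hω => ?_
  obtain ⟨h1, -⟩ := ladderTime_eq_coe hω
  rw [ENNReal.mul_iSup]
  refine iSup_le fun j => ?_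
  obtain ⟨i, rfl⟩ := Nat.exists_eq_add_of_le' h1
  refine le_trans (le_of_eq ?_) (le_iSup _ (i + j))
  rw [walk_eq, walk_eq, add_assoc, ← partialSum_add, ← mul_assoc, ← pow_add]
  congr 2 <;> [skip; congr 2] <;> omega

lemma tendsto_tailSup (hX : IsRandomWalk P ℱ X) {h : ℝ → ℝ≥0∞} (hh : Measurable h) {y : ℝ}
    (hfin : ∫⁻ ω, ⨆ n : ℕ, r ^ n * h (walk X y n ω) ∂P < ∞)
    (hlim : ∀ᵐ ω ∂P, Tendsto (fun n : ℕ => r ^ n * h (walk X y n ω)) atTop (𝓝 0)) :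
    Tendsto (fun n => tailSup P X r h n y) atTop (𝓝 0) := by
  have hw : ∀ n, Measurable fun ω => r ^ n * h (walk X y n ω) := fun n =>
    (hh.comp ((hX.measurable_walk y n).mono (ℱ.le n) le_rfl)).const_mul _
  have h0 : (0 : ℝ≥0∞) = ∫⁻ _, 0 ∂P := by simp
  rw [h0]
  unfold tailSup
  refine tendsto_lintegral_of_dominated_convergence _ (fun n => Measurable.iSup fun k => hw (n + k))
    (fun n => ae_of_all _ fun ω => ?_) hfin.ne ?_
  · exact iSup_le fun k => le_iSup (fun n => r ^ n * h (walk X y n ω)) (n + k)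
  · filter_upwards [hlim] with ω hω
    rw [ENNReal.tendsto_nhds_zero] at hω ⊢
    intro ε hε
    obtain ⟨N, hN⟩ := eventually_atTop.1 (hω ε hε)
    refine eventually_atTop.2 ⟨N, fun n hn => iSup_le fun k => hN _ (by omega)⟩

/-- Iterating the hypothesis `n` times leaves a remainder bounded by the supremum of the discounted
reward after time `n`, which tends to `0`. -/
lemma le_recordPotential [IsProbabilityMeasure P] (hX : IsRandomWalk P ℱ X) {G κ : ℝ → ℝ≥0∞}
    (hG : Measurable G) (hκ : Measurable κ) (hle : ∀ y, G y ≤ κ y + ladderOp P X r G y) {y : ℝ}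
    (hlim : Tendsto (fun n => tailSup P X r G n y) atTop (𝓝 0)) :
    G y ≤ recordPotential P X r κ y := by
  have key : ∀ n y, G y ≤ recordPotential P X r κ y + tailSup P X r G n y := by
    intro n
    induction n with
    | zero => exact fun y => le_add_left (le_tailSup_zero G y)
    | succ n ih =>
      intro y
      calc G y ≤ κ y + ladderOp P X r G y := hle y
        _ ≤ κ y + ladderOp P X r
            (fun z => recordPotential P X r κ z + tailSup P X r G n z) y := by
          gcongr
          exact ladderOp_mono hX fun z _ => ih z
        _ = κ y + ladderOp P X r (recordPotential P X r κ) y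
            + ladderOp P X r (tailSup P X r G n) y := by
          rw [add_assoc]
          congr 1
          exact stoppedReward_add hX (measurable_recordPotential hX hκ)
        _ ≤ _ := add_le_add (add_ladderOp_recordPotential_le hX hκ y)
          (ladderOp_tailSup_le hX hG n y)
  have h := hlim.const_add (recordPotential P X r κ y)
  rw [add_zero] at h
  exact ge_of_tendsto' h fun n => key n y

/-- Nothing is collected before `A` is entered, and the entrance into an upper set is a record, so
the whole sum is the sum restarted there. -/
lemma recordPotential_le_stoppedReward_hitting [IsProbabilityMeasure P] (hX : IsRandomWalk P ℱ X)
    {κ : ℝ → ℝ≥0∞} (hκ : Measurable κ) {A : Set ℝ} (hA : IsUpperSet A) (hAm : MeasurableSet A)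
    (hκA : ∀ z ∉ A, κ z = 0) (y : ℝ) :
    recordPotential P X r κ y
      ≤ stoppedReward P X r (recordPotential P X r κ) (hittingAfter (walk X y) A 0) y := by
  have hτ := hX.isStoppingTime_hittingAfter y hAm 0
  refine le_trans ?_ (stoppedReward_lintegral hX r hτ (measurable_recordSum r hκ) y).ge
  rw [recordPotential, lintegral_eq_tsum_stopping hτ, setLIntegral_congr_fun (g := fun _ => 0)
    (s := {ω | hittingAfter (walk X y) A 0 ω = ⊤}), lintegral_zero, add_zero]
  · refine ENNReal.tsum_le_tsum fun n => ?_
    refine setLIntegral_mono' (ℱ.le n _ (hτ.measurableSet_eq_coe n)) fun ω hω => ?_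
    obtain ⟨-, h2, h3⟩ := hittingAfter_eq_coe hω
    exact (recordSum_eq_mul_of_entrance hA hκA h2 fun j hj => h3 j (Nat.zero_le _) hj).le
  · exact hτ.measurableSet_eq_top
  · intro ω hω
    refine ENNReal.tsum_eq_zero.2 fun n => recordTerm_eq_zero (hκA _ ?_)
    exact hittingAfter_eq_top_iff.1 hω n (Nat.zero_le _)

end Verification

/-! ### Log-concavity as monotonicity of the ratios `g(· + s) / g`. -/

section LogConcave

lemma mul_le_mul_of_log_concave {g : ℝ → ℝ} {a : ℝ} (hpos : ∀ y, a < y → 0 < g y)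
    (hconc : ConcaveOn ℝ (Set.Ioi a) fun y => Real.log (g y)) {y z s : ℝ} (hy : a < y)
    (hyz : y ≤ z) (hs : 0 ≤ s) : g (z + s) * g y ≤ g z * g (y + s) := by
  rcases hyz.eq_or_lt with rfl | hyz
  · rw [mul_comm]
  have hd : 0 < z + s - y := by linarith
  -- `z` and `y + s` lie between `y` and `z + s` with complementary weights; adding the two
  -- concavity inequalities cancels the weights.
  set t := (z - y) / (z + s - y) with ht
  have ht0 : 0 ≤ t := div_nonneg (by linarith) hd.le
  have ht1 : 0 ≤ 1 - t := by
    rw [sub_nonneg, ht, div_le_one hd]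
    linarith
  have htd : t * (z + s - y) = z - y := div_mul_cancel₀ _ hd.ne'
  have hzs : a < z + s := by linarith
  have h1 := hconc.2 (Set.mem_Ioi.2 hy) (Set.mem_Ioi.2 hzs) ht1 ht0 (by ring)
  have h2 := hconc.2 (Set.mem_Ioi.2 hy) (Set.mem_Ioi.2 hzs) ht0 ht1 (by ring)
  have e1 : (1 - t) • y + t • (z + s) = z := by
    simp only [smul_eq_mul]
    linarith
  have e2 : t • y + (1 - t) • (z + s) = y + s := by
    simp only [smul_eq_mul]
    linarith
  rw [e1] at h1
  rw [e2] at h2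
  simp only [smul_eq_mul] at h1 h2
  have hgy := hpos y hy
  have hgz := hpos z (by linarith)
  have hgys := hpos (y + s) (by linarith)
  have hgzs := hpos (z + s) hzs
  rw [← Real.log_le_log_iff (mul_pos hgzs hgy) (mul_pos hgz hgys), Real.log_mul hgzs.ne' hgy.ne',
    Real.log_mul hgz.ne' hgys.ne']
  linarith

/-- At the endpoint `a`, where log-concavity is not assumed, the inequality is obtained by letting
`x ↓ a`: `g a ≤ g x` by monotonicity, and `g` is continuous at `a + s` since a concave function is
continuous on an open interval. -/
lemma mul_le_mul_of_log_concave_Ici {g : ℝ → ℝ} {a : ℝ} (hpos : ∀ y, a < y → 0 < g y)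
    (hmono : MonotoneOn g (Set.Ici a))
    (hconc : ConcaveOn ℝ (Set.Ioi a) fun y => Real.log (g y)) {y z s : ℝ} (hy : a ≤ y)
    (hyz : y ≤ z) (hs : 0 ≤ s) : g (z + s) * g y ≤ g z * g (y + s) := by
  rcases hy.lt_or_eq with hy | rfl
  · exact mul_le_mul_of_log_concave hpos hconc hy hyz hs
  rcases hyz.eq_or_lt with rfl | hyz
  · rw [mul_comm]
  rcases hs.eq_or_lt with rfl | hs
  · simp
  have hcont : ContinuousAt g (a + s) := by
    have h1 : ContinuousAt (fun y => Real.log (g y)) (a + s) :=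
      (hconc.continuousOn isOpen_Ioi).continuousAt (Ioi_mem_nhds (by linarith))
    refine (Real.continuous_exp.continuousAt.comp h1).congr ?_
    filter_upwards [Ioi_mem_nhds (show a < a + s by linarith)] with x hx
    exact Real.exp_log (hpos x hx)
  have hlim : Tendsto (fun x => g z * g (x + s)) (𝓝[>] a) (𝓝 (g z * g (a + s))) := by
    refine Tendsto.const_mul _ ?_
    have h2 : Tendsto (fun x => x + s) (𝓝[>] a) (𝓝 (a + s)) :=
      ((continuous_id.add continuous_const).tendsto a).mono_left nhdsWithin_le_nhds
    exact hcont.tendsto.comp h2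
  refine ge_of_tendsto hlim ?_
  filter_upwards [Ioo_mem_nhdsGT hyz] with x hx
  refine le_trans ?_ (mul_le_mul_of_log_concave hpos hconc hx.1 hx.2.le hs.le)
  exact mul_le_mul_of_nonneg_left (hmono Set.self_mem_Ici (Set.mem_Ici.2 hx.1.le) hx.1.le)
    (hpos _ (by linarith)).le

end LogConcave

/-! ### The verification theorem, and positivity. -/

section Optimality

variable {Ω : Type*} {m : MeasurableSpace Ω} {P : Measure Ω} {ℱ : Filtration ℕ m} {X : ℕ → Ω → ℝ}
  {r : ℝ≥0∞}

lemma measurable_ladderOp [IsProbabilityMeasure P] (hX : IsRandomWalk P ℱ X) {h : ℝ → ℝ≥0∞}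
    (hh : Measurable h) : Measurable (ladderOp P X r h) := by
  refine Measurable.tsum fun n => ?_
  have h1 : Measurable fun p : ℝ × Ω => r ^ n * h (p.1 + partialSum (fun i => X i p.2) n) :=
    (hh.comp (measurable_fst.add ((measurable_partialSum n).comp
      (hX.measurable_seq.comp measurable_snd)))).const_mul _
  exact h1.lintegral_prod_right'

lemma mul_ladderOp_le_mul_ladderOp (hX : IsRandomWalk P ℱ X) {h : ℝ → ℝ≥0∞} (hh : Measurable h)
    {y z : ℝ} {c d : ℝ≥0∞} (hcd : ∀ s, 0 ≤ s → c * h (z + s) ≤ d * h (y + s)) :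
    c * ladderOp P X r h z ≤ d * ladderOp P X r h y := by
  have hτ := hX.isStoppingTime_ladderTime
  have hw : ∀ y n, Measurable fun ω => r ^ n * h (walk X y n ω) := fun y n =>
    (hh.comp ((hX.measurable_walk y n).mono (ℱ.le n) le_rfl)).const_mul _
  unfold ladderOp stoppedReward
  rw [← ENNReal.tsum_mul_left, ← ENNReal.tsum_mul_left]
  refine ENNReal.tsum_le_tsum fun n => ?_
  rw [← lintegral_const_mul c (hw z n), ← lintegral_const_mul d (hw y n)]
  refine setLIntegral_mono' (ℱ.le n _ (hτ.measurableSet_eq_coe n)) fun ω hω => ?_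
  rw [mul_left_comm, mul_left_comm d]
  refine mul_le_mul' le_rfl ?_
  exact hcd _ (ladderTime_eq_coe hω).2.1.le

/-- If `h` is bounded below on a half-line, the discounted ladder height has mass `< 1`. -/
lemma ladderOp_one_lt_one [IsProbabilityMeasure P] (hX : IsRandomWalk P ℱ X) {h : ℝ → ℝ≥0∞}
    (hh : Measurable h) {c : ℝ≥0∞} (hc : c ≠ 0) {y₀ : ℝ} (hch : ∀ z, y₀ ≤ z → c ≤ h z)
    (hlim : Tendsto (fun n => tailSup P X r h n y₀) atTop (𝓝 0)) :
    ladderOp P X r (fun _ => 1) 0 < 1 := by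
  by_contra hq
  push Not at hq
  -- With ladder mass at least `1`, the lower bound `c` survives every restart at a ladder epoch, so
  -- the tail suprema could not tend to `0`.
  have key : ∀ n y, y₀ ≤ y → c ≤ tailSup P X r h n y := by
    intro n
    induction n with
    | zero => exact fun y hy => (hch y hy).trans (le_tailSup_zero h y)
    | succ n ih =>
      intro y hy
      have h1 := ladderOp_const_mul (P := P) (r := r) hX (h := fun _ => 1) measurable_const c y
      calc c ≤ c * ladderOp P X r (fun _ => 1) 0 := le_mul_of_one_le_right' hq
        _ = ladderOp P X r (fun _ => c * 1) y := h1.symm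
        _ ≤ ladderOp P X r (tailSup P X r h n) y :=
          ladderOp_mono hX fun z hz => by simpa using ih z (hy.trans hz.le)
        _ ≤ _ := ladderOp_tailSup_le hX hh n y
  exact hc (le_zero_iff.1 (ge_of_tendsto' hlim fun n => key n y₀ le_rfl))

/-- This is stated for any upper set `A`, so that it covers both the closed and the open half-line.
-/
lemma exists_superharmonic_eq_value [IsProbabilityMeasure P] (hX : IsRandomWalk P ℱ X)
    {ρ : ℝ} (hρ0 : 0 ≤ ρ) (hρ1 : ρ ≤ 1) {g : ℝ → ℝ} (hg : Measurable g) {A : Set ℝ}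
    (hA : IsUpperSet A) (hAm : MeasurableSet A)
    (hq : ladderOp P X (ENNReal.ofReal ρ) (fun _ => 1) 0 < 1)
    (hlim : ∀ y, Tendsto (fun n => tailSup P X (ENNReal.ofReal ρ)
      (fun z => ENNReal.ofReal (g z)) n y) atTop (𝓝 0))
    (hout : ∀ y ∉ A, ENNReal.ofReal (g y)
      ≤ ladderOp P X (ENNReal.ofReal ρ) (fun z => ENNReal.ofReal (g z)) y)
    (hin : ∀ y ∈ A, ladderOp P X (ENNReal.ofReal ρ) (fun z => ENNReal.ofReal (g z)) y
      ≤ ENNReal.ofReal (g y))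
    (hmono : MonotoneOn (fun y => ENNReal.ofReal (g y)
      - ladderOp P X (ENNReal.ofReal ρ) (fun z => ENNReal.ofReal (g z)) y) A) :
    ∃ w : ℝ → ℝ≥0∞, (∀ y, ENNReal.ofReal ρ * ∫⁻ ω, w (y + X 0 ω) ∂P ≤ w y) ∧ Measurable w ∧
      (∀ y ∈ A, w y = ENNReal.ofReal (g y)) ∧ (∀ y, value P ℱ X ρ g y = w y) ∧
      EntranceTimeOptimal P ℱ X ρ g A := by
  classical
  set r := ENNReal.ofReal ρ with hr
  set G : ℝ → ℝ≥0∞ := fun z => ENNReal.ofReal (g z) with hG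
  have hr1 : r ≤ 1 := ENNReal.ofReal_le_one.2 hρ1
  have hGm : Measurable G := hg.ennreal_ofReal
  set κ : ℝ → ℝ≥0∞ := A.indicator fun y => G y - ladderOp P X r G y with hκ
  have hκm : Measurable κ := (hGm.sub (measurable_ladderOp hX hGm)).indicator hAm
  have hκA : ∀ z ∉ A, κ z = 0 := fun z hz => Set.indicator_of_notMem hz _
  have hκA' : ∀ z ∈ A, κ z = G z - ladderOp P X r G z := fun z hz => Set.indicator_of_mem hz _
  have hκmono : Monotone κ := by
    intro y z hyz
    by_cases hy : y ∈ A
    · rw [hκA' y hy, hκA' z (hA hyz hy)]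
      exact hmono hy (hA hyz hy) hyz
    · rw [hκA y hy]
      exact zero_le
  set w := recordPotential P X r κ with hw
  have hwm : Measurable w := measurable_recordPotential hX hκm
  have hsup : ∀ y, r * ∫⁻ ω, w (y + X 0 ω) ∂P ≤ w y :=
    recordPotential_superharmonic hX hr1 hq hκm hκmono
  have hGw : ∀ y, G y ≤ w y := fun y => by
    refine le_recordPotential hX hGm hκm (fun y => ?_) (hlim y)
    by_cases hy : y ∈ A
    · rw [hκA' y hy]
      exact le_tsub_add
    · exact le_add_left (hout y hy)
  have hwG : ∀ y ∈ A, w y ≤ G y := fun y hy => by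
    -- The value `∞` off `A` makes the supersolution inequality trivial there; it is never seen from
    -- inside `A`, because ladder heights go up and `A` is an upper set.
    have h := recordPotential_le (r := r) hX hκm (h := fun z => if z ∈ A then G z else ∞)
      (fun z => ?_) y
    · simpa [hy] using h
    · by_cases hz : z ∈ A
      · simp only [hz, if_true]
        rw [hκA' z hz]
        refine le_trans ?_ (tsub_add_cancel_of_le (hin z hz)).le
        gcongr
        exact ladderOp_mono hX fun x hx => by simp [hA hx.le hz]
      · simp [hz]
  have hVw : ∀ y, value P ℱ X ρ g y ≤ w y := fun y => by
    refine iSup₂_le fun τ hτ => ?_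
    rw [expectedReward_eq_stoppedReward hτ hρ0]
    exact (stoppedReward_mono hτ fun ω n _ => hGw _).trans
      (stoppedReward_le_of_superharmonic hX hwm hsup hτ y)
  have hwU : ∀ y, w y ≤ expectedReward P ρ g (walk X y) (hittingAfter (walk X y) A 0) := fun y => by
    have hτ := hX.isStoppingTime_hittingAfter y hAm 0
    rw [expectedReward_eq_stoppedReward hτ hρ0]
    refine (recordPotential_le_stoppedReward_hitting hX hκm hA hAm hκA y).trans ?_
    exact stoppedReward_mono hτ fun ω n hn => hwG _ (hittingAfter_eq_coe hn).2.1
  have hUV : ∀ y, expectedReward P ρ g (walk X y) (hittingAfter (walk X y) A 0)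
      ≤ value P ℱ X ρ g y := fun y =>
    le_iSup₂ (f := fun (τ : Ω → WithTop ℕ) (_ : IsStoppingTime ℱ τ) =>
      expectedReward P ρ g (walk X y) τ) _ (hX.isStoppingTime_hittingAfter y hAm 0)
  exact ⟨w, hsup, hwm, fun y hy => (hwG y hy).antisymm (hGw y),
    fun y => (hVw y).antisymm ((hwU y).trans (hUV y)),
    fun y => ⟨hX.isStoppingTime_hittingAfter y hAm 0,
      (hUV y).antisymm ((hVw y).trans (hwU y))⟩⟩

lemma phi_eq_ladderOp (hX : IsRandomWalk P ℱ X) {ρ : ℝ} (hρ0 : 0 ≤ ρ) (g : ℝ → ℝ) (y : ℝ) :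
    phi P X ρ g y = ladderOp P X (ENNReal.ofReal ρ) (fun z => ENNReal.ofReal (g z)) y := by
  unfold phi ladderOp
  rw [exceedTime_eq_ladderTime, expectedReward_eq_stoppedReward hX.isStoppingTime_ladderTime hρ0]

lemma phi_le_value (hX : IsRandomWalk P ℱ X) (ρ : ℝ) (g : ℝ → ℝ) (y : ℝ) :
    phi P X ρ g y ≤ value P ℱ X ρ g y :=
  le_iSup₂ (f := fun (τ : Ω → WithTop ℕ) (_ : IsStoppingTime ℱ τ) =>
      expectedReward P ρ g (walk X y) τ) _
    (hX.isStoppingTime_hittingAfter y measurableSet_Ioi 1)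

lemma expectedReward_ladder_ratio_le_one_iff (hX : IsRandomWalk P ℱ X) {ρ : ℝ} (hρ0 : 0 ≤ ρ)
    {g : ℝ → ℝ} {z : ℝ} (hz : 0 < g z) :
    expectedReward P ρ (fun s => g (z + s) / g z) (walk X 0) (ladderTime X) ≤ 1
      ↔ phi P X ρ g z ≤ ENNReal.ofReal (g z) := by
  have hτ := hX.isStoppingTime_ladderTime
  have hc0 : ENNReal.ofReal (g z) ≠ 0 := by simpa using hz
  have key : phi P X ρ g z = ENNReal.ofReal (g z)
      * expectedReward P ρ (fun s => g (z + s) / g z) (walk X 0) (ladderTime X) := by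
    rw [phi_eq_ladderOp hX hρ0, expectedReward_eq_stoppedReward hτ hρ0]
    unfold ladderOp stoppedReward
    rw [← ENNReal.tsum_mul_left]
    refine tsum_congr fun n => ?_
    rw [← lintegral_const_mul']
    · refine lintegral_congr fun ω => ?_
      rw [mul_left_comm, ← ENNReal.ofReal_mul hz.le, mul_div_cancel₀ _ hz.ne', walk_eq, walk_eq,
        zero_add]
    · exact ENNReal.ofReal_ne_top
  rw [key]
  have h := ENNReal.mul_le_mul_iff_right hc0 ENNReal.ofReal_ne_top
    (b := expectedReward P ρ (fun s => g (z + s) / g z) (walk X 0) (ladderTime X)) (c := 1)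
  rw [mul_one] at h
  exact h.symm

/-- The event that the first step is already positive contributes enough. -/
lemma ladderOp_pos (hX : IsRandomWalk P ℱ X) (hpos : 0 < P {ω | 0 < X 0 ω}) (hr : r ≠ 0)
    {h : ℝ → ℝ≥0∞} (hh : Measurable h) {y : ℝ} (hy : ∀ z, y < z → h z ≠ 0) :
    0 < ladderOp P X r h y := by
  refine lt_of_lt_of_le ?_ (ENNReal.le_tsum 1)
  have hw : Measurable fun ω => r ^ 1 * h (walk X y 1 ω) :=
    (hh.comp ((hX.measurable_walk y 1).mono (ℱ.le 1) le_rfl)).const_mul _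
  rw [setLIntegral_pos_iff hw]
  refine hpos.trans_le (measure_mono fun ω hω => ?_)
  have hω' : 0 < X 0 ω := hω
  refine ⟨?_, ?_⟩
  · refine mul_ne_zero (pow_ne_zero _ hr) (hy _ ?_)
    simpa [walk] using hω'
  · refine le_antisymm (hittingAfter_le_of_mem le_rfl ?_) (le_hittingAfter ω)
    simpa [walk] using hω'

lemma exists_pos_measure_lt {f : Ω → ℝ} (hpos : 0 < P {ω | 0 < f ω}) :
    ∃ δ > 0, 0 < P {ω | δ < f ω} := by
  by_contra! h
  refine hpos.ne' (measure_mono_null (t := ⋃ n : ℕ, {ω | 1 / ((n : ℝ) + 1) < f ω}) ?_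
    (measure_iUnion_null fun n => le_zero_iff.1 (h _ (by positivity))))
  intro ω hω
  obtain ⟨n, hn⟩ := exists_nat_one_div_lt (show 0 < f ω from hω)
  exact Set.mem_iUnion.2 ⟨n, hn⟩

/-- A superharmonic function that is positive on a half-line is positive everywhere. -/
lemma superharmonic_pos (hX : IsRandomWalk P ℱ X) (hpos : 0 < P {ω | 0 < X 0 ω}) (hr : r ≠ 0)
    {w : ℝ → ℝ≥0∞} (hw : Measurable w) (hsup : ∀ y, r * ∫⁻ ω, w (y + X 0 ω) ∂P ≤ w y) {a : ℝ}
    (ha : ∀ y, a ≤ y → 0 < w y) (y : ℝ) : 0 < w y := by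
  obtain ⟨δ, hδ, hPδ⟩ := exists_pos_measure_lt hpos
  -- Each use of superharmonicity pushes positivity down by `δ`, since steps larger than `δ` have
  -- positive probability.
  have key : ∀ k : ℕ, ∀ y, a - k * δ ≤ y → 0 < w y := by
    intro k
    induction k with
    | zero => simpa using ha
    | succ k ih =>
      intro y hy
      push_cast at hy
      refine lt_of_lt_of_le ?_ (hsup y)
      suffices hint : 0 < ∫⁻ ω, w (y + X 0 ω) ∂P from ENNReal.mul_pos hr hint.ne'
      rw [lintegral_pos_iff_support (f := fun ω => w (y + X 0 ω)) (hw.comp ((hX.measurable 0).const_add y))]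
      refine hPδ.trans_le (measure_mono fun ω hω => ?_)
      have hω' : δ < X 0 ω := hω
      exact (ih _ (by linarith)).ne'
  obtain ⟨k, hk⟩ := exists_nat_ge ((a - y) / δ)
  refine key k y ?_
  rw [div_le_iff₀ hδ] at hk
  linarith

end Optimality

/-! ### Consequences of (Opt), of the definition of `α*`, and of the sign of `f`. -/

section Threshold

variable {Ω : Type*} {m : MeasurableSpace Ω} {P : Measure Ω} {ℱ : Filtration ℕ m} {X : ℕ → Ω → ℝ}

lemma ofReal_pow_mul {ρ : ℝ} (hρ0 : 0 ≤ ρ) (n : ℕ) (x : ℝ) :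
    ENNReal.ofReal (ρ ^ n * x) = ENNReal.ofReal ρ ^ n * ENNReal.ofReal x := by
  rw [ENNReal.ofReal_mul (pow_nonneg hρ0 n), ENNReal.ofReal_pow hρ0]

lemma ConditionOpt.lintegral_lt_top {ρ : ℝ} (hρ0 : 0 ≤ ρ) {g : ℝ → ℝ} (h : ConditionOpt P X ρ g)
    (y : ℝ) : ∫⁻ ω, ⨆ n : ℕ, ENNReal.ofReal ρ ^ n * ENNReal.ofReal (g (walk X y n ω)) ∂P < ∞ := by
  simpa only [ofReal_pow_mul hρ0] using (h y).1

lemma ConditionOpt.tendsto_tailSup (hX : IsRandomWalk P ℱ X) {ρ : ℝ} (hρ0 : 0 ≤ ρ) {g : ℝ → ℝ}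
    (hg : Measurable g) (h : ConditionOpt P X ρ g) (y : ℝ) :
    Tendsto (fun n => tailSup P X (ENNReal.ofReal ρ) (fun z => ENNReal.ofReal (g z)) n y) atTop
      (𝓝 0) := by
  refine LadderStopping.tendsto_tailSup hX hg.ennreal_ofReal (h.lintegral_lt_top hρ0 y) ?_
  filter_upwards [(h y).2] with ω hω
  simpa only [ofReal_pow_mul hρ0, ENNReal.ofReal_zero] using ENNReal.tendsto_ofReal hω

lemma ConditionOpt.ladderOp_ne_top [IsProbabilityMeasure P] (hX : IsRandomWalk P ℱ X) {ρ : ℝ}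
    (hρ0 : 0 ≤ ρ) {g : ℝ → ℝ} (hg : Measurable g) (h : ConditionOpt P X ρ g) (y : ℝ) :
    ladderOp P X (ENNReal.ofReal ρ) (fun z => ENNReal.ofReal (g z)) y ≠ ∞ := by
  refine ne_top_of_le_ne_top (h.lintegral_lt_top hρ0 y).ne ?_
  calc _ ≤ ladderOp P X (ENNReal.ofReal ρ)
        (tailSup P X (ENNReal.ofReal ρ) (fun z => ENNReal.ofReal (g z)) 0) y :=
        ladderOp_mono hX fun z _ => le_tailSup_zero (fun z => ENNReal.ofReal (g z)) z
    _ ≤ _ := ladderOp_tailSup_le hX hg.ennreal_ofReal 0 y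
    _ ≤ _ := lintegral_mono fun ω => iSup_le fun k =>
        le_iSup (fun n => ENNReal.ofReal ρ ^ n * ENNReal.ofReal (g (walk X y n ω))) (0 + 1 + k)

/-- If `h(z)/g(z) ≤ h(y)/g(y) ≤ 1` and `g(y) ≤ g(z)`, then `g(y) - h(y) ≤ g(z) - h(z)`. -/
lemma sub_le_sub_of_mul_le_mul {b c : ℝ} {p q : ℝ≥0∞} (hb : 0 ≤ b) (hbc : b ≤ c) (hp : p ≠ ∞)
    (hq : q ≠ ∞) (hpb : p ≤ ENNReal.ofReal b)
    (h : ENNReal.ofReal b * q ≤ ENNReal.ofReal c * p) :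
    ENNReal.ofReal b - p ≤ ENNReal.ofReal c - q := by
  rcases hb.eq_or_lt with rfl | hb
  · simp
  obtain ⟨p, hp0, rfl⟩ : ∃ p' : ℝ, 0 ≤ p' ∧ p = ENNReal.ofReal p' :=
    ⟨p.toReal, ENNReal.toReal_nonneg, (ENNReal.ofReal_toReal hp).symm⟩
  obtain ⟨q, hq0, rfl⟩ : ∃ q' : ℝ, 0 ≤ q' ∧ q = ENNReal.ofReal q' :=
    ⟨q.toReal, ENNReal.toReal_nonneg, (ENNReal.ofReal_toReal hq).symm⟩
  rw [ENNReal.ofReal_le_ofReal_iff hb.le] at hpb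
  rw [← ENNReal.ofReal_mul hb.le, ← ENNReal.ofReal_mul (hb.le.trans hbc),
    ENNReal.ofReal_le_ofReal_iff (mul_nonneg (hb.le.trans hbc) hp0)] at h
  rw [← ENNReal.ofReal_sub _ hp0, ← ENNReal.ofReal_sub _ hq0]
  refine ENNReal.ofReal_le_ofReal (le_of_mul_le_mul_left ?_ hb)
  -- In real terms, `b (c - q) ≥ c (b - p) ≥ b (b - p)`.
  nlinarith [mul_le_mul_of_nonneg_right hbc (sub_nonneg.2 hpb)]

/-- Outside of `{z > b : φ(z) ≤ g(z)}`, stopping is improved by waiting for the next maximum. -/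
lemma ofReal_lt_phi_of_lt {ρ : ℝ} {g : ℝ → ℝ} {b : EReal} {a y : ℝ}
    (hα : alphaStar P X ρ g b = a) (hby : b < y) (hy : y < a) :
    ENNReal.ofReal (g y) < phi P X ρ g y := by
  by_contra h
  push Not at h
  have h1 : alphaStar P X ρ g b ≤ y := sInf_le ⟨y, ⟨hby, h⟩, rfl⟩
  rw [hα] at h1
  exact absurd (EReal.coe_le_coe_iff.1 h1) (not_le.2 hy)

lemma le_of_alphaStar_eq {ρ : ℝ} {g : ℝ → ℝ} {b : EReal} {a : ℝ}
    (hα : alphaStar P X ρ g b = a) : b ≤ a := by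
  rw [← hα]
  refine le_sInf ?_
  rintro _ ⟨z, hz, rfl⟩
  exact hz.1.le

lemma fFun_sign [IsProbabilityMeasure P] (hX : IsRandomWalk P ℱ X) {ρ : ℝ} (hρ0 : 0 ≤ ρ)
    {g : ℝ → ℝ} {a : ℝ} (hg : 0 ≤ g a)
    (hq : ladderOp P X (ENNReal.ofReal ρ) (fun _ => 1) 0 < 1) (hfin : phi P X ρ g a ≠ ∞) :
    (0 ≤ fFun P X ρ g a ↔ phi P X ρ g a ≤ ENNReal.ofReal (g a)) ∧
    (fFun P X ρ g a ≤ 0 ↔ ENNReal.ofReal (g a) ≤ phi P X ρ g a) := by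
  have hQ : expectedReward P ρ (fun _ => 1) (walk X a) (exceedTime X a)
      = ladderOp P X (ENNReal.ofReal ρ) (fun _ => 1) 0 := by
    have h := phi_eq_ladderOp (P := P) hX hρ0 (fun _ => 1) a
    simp only [ENNReal.ofReal_one] at h
    exact h
  have hc : 0 < 1 / (1 - (ladderOp P X (ENNReal.ofReal ρ) (fun _ => 1) 0).toReal) := by
    refine one_div_pos.2 (sub_pos.2 ?_)
    have := (ENNReal.toReal_lt_toReal hq.ne_top ENNReal.one_ne_top).2 hq
    simpa using this
  unfold fFun
  have hneg : ∀ x, 1 / (1 - (ladderOp P X (ENNReal.ofReal ρ) (fun _ => 1) 0).toReal) * x ≤ 0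
      ↔ x ≤ 0 := fun x =>
    not_lt.symm.trans ((not_congr (mul_pos_iff_of_pos_left hc)).trans not_lt)
  rw [hQ, mul_nonneg_iff_of_pos_left hc, hneg, sub_nonneg, sub_nonpos]
  exact ⟨(ENNReal.le_ofReal_iff_toReal_le hfin hg).symm,
    (ENNReal.ofReal_le_iff_le_toReal hfin).symm⟩

end Threshold

end LadderStopping

/-! ### The main theorem. -/

open LadderStopping in
theorem mainTheorem3 {Ω : Type*} {m : MeasurableSpace Ω} (P : Measure Ω) [IsProbabilityMeasure P]
    (ℱ : Filtration ℕ m) (X : ℕ → Ω → ℝ) (hX : IsRandomWalk P ℱ X)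
    (hpos : 0 < P {ω | 0 < X 0 ω})
    (ρ : ℝ) (hρ0 : 0 < ρ) (hρ1 : ρ ≤ 1)
    (g : ℝ → ℝ) (hg_meas : Measurable g) (hg_nonneg : ∀ y, 0 ≤ g y)
    (b : EReal) (hb : b ≠ ⊤) (hgb : ∀ y : ℝ, 0 < g y ↔ b < (y : EReal)) :
    alphaStar P X ρ g b =
        sInf ((fun z : ℝ => (z : EReal)) '' {z : ℝ | b < z ∧
          expectedReward P ρ (fun s => g (z + s) / g z) (walk X 0) (ladderTime X) ≤ 1}) ∧
    ∀ a : ℝ, alphaStar P X ρ g b = (a : EReal) →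
      MonotoneOn g (Set.Ici a) →
      ConcaveOn ℝ (Set.Ioi a) (fun y => Real.log (g y)) →
      ConditionOpt P X ρ g →
        (0 ≤ fFun P X ρ g a →
          EntranceTimeOptimal P ℱ X ρ g (Set.Ici a) ∧
            stoppingSet P ℱ X ρ g = Set.Ici a) ∧
        (fFun P X ρ g a ≤ 0 → EntranceTimeOptimal P ℱ X ρ g (Set.Ioi a)) := by
  refine ⟨?_, fun a hα hmono hconc hOpt => ?_⟩
  · unfold alphaStar
    congr 2
    ext z
    refine and_congr_right fun hz => ?_
    exact (expectedReward_ladder_ratio_le_one_iff hX hρ0.le ((hgb z).2 hz)).symm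
  have hr0 : ENNReal.ofReal ρ ≠ 0 := by simpa using hρ0
  have hGm : Measurable fun z => ENNReal.ofReal (g z) := hg_meas.ennreal_ofReal
  have hba : b ≤ a := le_of_alphaStar_eq hα
  have hgpos : ∀ y, a < y → 0 < g y := fun y hy =>
    (hgb y).2 (hba.trans_lt (EReal.coe_lt_coe_iff.2 hy))
  have hlim := hOpt.tendsto_tailSup hX hρ0.le hg_meas
  have hfin := hOpt.ladderOp_ne_top hX hρ0.le hg_meas
  have hφ := phi_eq_ladderOp (P := P) hX hρ0.le g
  have hq : ladderOp P X (ENNReal.ofReal ρ) (fun _ => 1) 0 < 1 := by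
    -- The base point is `a + 1` rather than `a` because `g a` may vanish, namely when `b = a`.
    refine ladderOp_one_lt_one hX hGm (c := ENNReal.ofReal (g (a + 1))) (y₀ := a + 1) ?_ ?_
      (hlim (a + 1))
    · simpa using hgpos (a + 1) (by linarith)
    · intro z hz
      exact ENNReal.ofReal_le_ofReal (hmono (Set.mem_Ici.2 (by linarith))
        (Set.mem_Ici.2 (by linarith)) hz)
  obtain ⟨hf0, hf1⟩ := fFun_sign hX hρ0.le (hg_nonneg a) hq (by rw [hφ]; exact hfin a)
  -- This says that `φ/g` decreases on `[a, ∞)`; the cross-multiplied form also covers `g a = 0`.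
  have hmul : ∀ y z, a ≤ y → y ≤ z →
      ENNReal.ofReal (g y) * phi P X ρ g z ≤ ENNReal.ofReal (g z) * phi P X ρ g y := by
    intro y z hy hyz
    rw [hφ, hφ]
    refine mul_ladderOp_le_mul_ladderOp hX hGm fun s hs => ?_
    rw [← ENNReal.ofReal_mul (hg_nonneg y), ← ENNReal.ofReal_mul (hg_nonneg z), mul_comm]
    exact ENNReal.ofReal_le_ofReal
      (mul_le_mul_of_log_concave_Ici hgpos hmono hconc hy hyz hs)
  have hbelow : ∀ y < a, ENNReal.ofReal (g y) ≤ phi P X ρ g y := by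
    intro y hy
    by_cases hby : b < y
    · exact (ofReal_lt_phi_of_lt hα hby hy).le
    · rw [ENNReal.ofReal_of_nonpos (not_lt.1 fun h => hby ((hgb y).1 h))]
      exact zero_le
  have habove : ∀ y, a < y → phi P X ρ g y ≤ ENNReal.ofReal (g y) := by
    intro y hy
    have h1 : alphaStar P X ρ g b < y := by
      rw [hα]
      exact EReal.coe_lt_coe_iff.2 hy
    -- Some `z < y` has `φ(z) ≤ g(z)`, and the decreasing ratio carries this inequality up to `y`.
    obtain ⟨_, ⟨z, ⟨hbz, hz⟩, rfl⟩, hzy⟩ := sInf_lt_iff.1 h1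
    have haz : a ≤ z := by
      by_contra h
      exact absurd (ofReal_lt_phi_of_lt hα hbz (not_le.1 h)) (not_lt.2 hz)
    have hz0 : ENNReal.ofReal (g z) ≠ 0 := by simpa using (hgb z).2 hbz
    refine (ENNReal.mul_le_mul_iff_right hz0 ENNReal.ofReal_ne_top).1 ?_
    refine (hmul z y haz (EReal.coe_lt_coe_iff.1 hzy).le).trans ?_
    rw [mul_comm]
    exact mul_le_mul' hz le_rfl
  have hκmono : ∀ A ⊆ Set.Ici a, (∀ y ∈ A, phi P X ρ g y ≤ ENNReal.ofReal (g y)) →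
      MonotoneOn (fun y => ENNReal.ofReal (g y)
        - ladderOp P X (ENNReal.ofReal ρ) (fun z => ENNReal.ofReal (g z)) y) A := by
    intro A hAa hA y hy z hz hyz
    refine sub_le_sub_of_mul_le_mul (hg_nonneg y) (hmono (hAa hy) (hAa hz) hyz) (hfin y) (hfin z)
      ?_ ?_
    · rw [← hφ]
      exact hA y hy
    · rw [← hφ, ← hφ]
      exact hmul y z (hAa hy) hyz
  refine ⟨fun hf => ?_, fun hf => ?_⟩
  · have ha := hf0.1 hf
    have hin : ∀ y ∈ Set.Ici a, phi P X ρ g y ≤ ENNReal.ofReal (g y) := fun y hy =>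
      (Set.mem_Ici.1 hy).eq_or_lt.elim (fun h => h ▸ ha) (habove y)
    obtain ⟨w, hsup, hwm, hwA, hVw, hopt⟩ := exists_superharmonic_eq_value hX hρ0.le hρ1 hg_meas
      (isUpperSet_Ici a) measurableSet_Ici hq hlim
      (fun y hy => by
        rw [← hφ]
        exact hbelow y (not_le.1 hy))
      (fun y hy => by
        rw [← hφ]
        exact hin y hy)
      (hκmono _ le_rfl hin)
    refine ⟨hopt, Set.ext fun y => ⟨fun hy => ?_, fun hy => (hVw y).trans (hwA y hy)⟩⟩
    have hy' : value P ℱ X ρ g y = ENNReal.ofReal (g y) := hy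
    by_contra hya
    have hya' : y < a := not_le.1 hya
    by_cases hby : b < y
    · refine absurd (phi_le_value hX ρ g y) (not_le.2 ?_)
      rw [hy']
      exact ofReal_lt_phi_of_lt hα hby hya'
    -- Here `g y = 0`, so it is enough that `V y > 0`. The bound `g a ≥ φ(a) > 0` makes `w` positive
    -- on `[a, ∞)`, hence everywhere.
    · have hga : 0 < ENNReal.ofReal (g a) := by
        refine lt_of_lt_of_le ?_ ha
        rw [hφ]
        exact ladderOp_pos hX hpos hr0 hGm fun z hz => by simpa using hgpos z hz
      have hwpos : 0 < w y := by
        refine superharmonic_pos hX hpos hr0 hwm hsup (a := a) (fun z hz => ?_) y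
        rw [hwA z hz]
        exact hga.trans_le (ENNReal.ofReal_le_ofReal (hmono Set.self_mem_Ici hz hz))
      rw [← hVw, hy', ENNReal.ofReal_pos] at hwpos
      exact hby ((hgb y).1 hwpos)
  -- Now `g a ≤ φ(a)`, so `a` belongs to the continuation side and `A` is the open half-line.
  · have ha := hf1.1 hf
    obtain ⟨-, -, -, -, -, hopt⟩ := exists_superharmonic_eq_value hX hρ0.le hρ1 hg_meas
      (isUpperSet_Ioi a) measurableSet_Ioi hq hlim
      (fun y hy => by
        rw [← hφ]
        rcases (not_lt.1 (Set.mem_Ioi.not.1 hy)).eq_or_lt with rfl | h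
        · exact ha
        · exact hbelow y h)
      (fun y hy => by
        rw [← hφ]
        exact habove y hy)
      (hκmono _ Set.Ioi_subset_Ici_self fun y hy => habove y hy)
    exact hopt
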